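/- **Setting.** Let $\mu$ be a partition of $n+1$ with $m$ corners, and let $\alpha^{(1)},\dots,\alpha^{(m)}$ be the partitions of $n$ obtained from $\mu$ by removing one corner. For a partition $\alpha$ put $T_\alpha=\prod_{(i,j)\in\alpha}t^{i}q^{j}$, where $i,j\ge 0$ are the row and column index of a cell, and write $T_i=T_{\alpha^{(i)}}$. Let $\widetilde H_\alpha(x;q,t)=t^{n(\alpha)}J_\alpha[X/(1-1/t);q,1/t]$ be the modified Macdonald polynomial, where $n(\alpha)$ is the sum of the row indices of the cells and $J_\alpha$ is Macdonald's integral form. Let $\nabla$ be the linear operator on symmetric functions over $\mathbb Q(q,t)$ with $\nabla\widetilde H_\alpha=T_\alpha\widetilde H_\alpha$ for all $\alpha$. For $\alpha\vdash n$ with cells $(p_1,r_1),\dots,(p_n,r_n)$ let $\Delta_\alpha=\det\|x_i^{p_j}y_i^{r_j}\|_{i,j\le n}$, let $\mathbf M_\alpha$ be the span over $\mathbb{Q}$ of all partial derivatives of $\Delta_\alpha$, and let $\mathbf{flip}_\alpha P=P(\partial_x,\partial_y)\Delta_\alpha$. The group $S_n$ acts diagonally on polynomials in $x_1,\dots,x_n,y_1,\dots,y_n$.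 For a bigraded $S_n$-invariant space $\mathbf W$ of such polynomials let $\mathcal F\,\mathbf W=\frac1{n!}\sum_{\sigma\in S_n}\sum_{h,k}t^hq^k\,\mathrm{tr}(\sigma|_{\mathbf W_{h,k}})\,p_{\lambda(\sigma)}$ be its Frobenius characteristic, where $\mathbf W_{h,k}$ is the part of degree $h$ in $x$ and $k$ in $y$, and $\lambda(\sigma)$ is the cycle type of $\sigma$. Finally put $$\Phi_\mu=\sum_{j=1}^m\Bigl(\prod_{s\ne j}\frac1{1-T_j/T_s}\Bigr)\widetilde H_{\alpha^{(j)}}.$$ **Hypotheses.** 1. (The $C=\widetilde H$ conjecture for the predecessors of $\mu$.) $\mathcal F\,\mathbf M_{\alpha^{(i)}}=\widetilde H_{\alpha^{(i)}}$ for $i=1,\dots,m$. 2. (From the "science fiction" heuristic for $\mu$.) The space $\bigvee_i\mathbf M_{\alpha^{(i)}}=\sum_i\mathbf M_{\alpha^{(i)}}$ has a basis $\mathcal B$ of bihomogeneous polynomials, with subsets $\mathcal B_i\subseteq\mathcal B$ spanning $\mathbf M_{\alpha^{(i)}}$, such that, writing $\mathbf M^{=S}$ for the span of those $b\in\mathcal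 B$ that lie in $\mathcal B_i$ exactly for $i\in S$: - for every $S\subseteq\{1,\dots,m\}$ the space $\mathbf M^{=S}$ is $S_n$-invariant; - for every $S$ and $i\in S$, $\ \mathbf{flip}_{\alpha^{(i)}}\mathbf M^{=S}\cong\mathbf M^{=\{i\}\cup S^c}$ as bigraded $S_n$-modules. **Theorem 3.2.** Under these hypotheses there are unique symmetric functions $\Phi^{(1)},\dots,\Phi^{(m)}$ such that $\mathcal F\,\mathbf M^{=S}=\Phi^{(|S|)}/\prod_{i\notin S}T_i$ for every nonempty $S\subseteq\{1,\dots,m\}$, and they satisfy $$\mathcal F\bigvee_{i=1}^m\mathbf M_{\alpha^{(i)}}=\sum_{k=1}^m\Phi^{(k)}\,e_{m-k}\Bigl[\frac1{T_1}+\cdots+\frac1{T_m}\Bigr]=\frac{\nabla\Phi^{(1)}}{T_1T_2\cdots T_m},$$ $$\sum_{k=1}^m\Phi^{(k)}\,e_{m+1-k}\Bigl[\frac1{T_1}+\cdots+\frac1{T_m}\Bigr]=\nabla^{-1}\Phi_\mu .$$ -/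

import Mathlib

open scoped BigOperators

namespace MacdonaldSF

noncomputable section

/- ## Partitions, as Young diagrams

A cell `(i, j)` of a diagram lies in row `i` and column `j`, both counted from `0`. -/

/-- The leg of a cell: the number of cells of `α` in the same column and a strictly higher row. -/
def leg (α : YoungDiagram) (c : ℕ × ℕ) : ℕ := α.colLen c.2 - (c.1 + 1)

/-- The arm of a cell: the number of cells of `α` strictly further on in the same row. -/
def arm (α : YoungDiagram) (c : ℕ × ℕ) : ℕ := α.rowLen c.1 - (c.2 + 1)

/-- `n(α) = ∑ (i - 1) αᵢ`, the sum of the row indices (from `0`) of all cells. -/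
def nStat (α : YoungDiagram) : ℕ := ∑ c ∈ α.cells, c.1

/-- Strict dominance order `α < β` on partitions of the same number. -/
def DomLT (α β : YoungDiagram) : Prop :=
  α.card = β.card ∧ α ≠ β ∧
    ∀ k : ℕ, ∑ i ∈ Finset.range k, α.rowLen i ≤ ∑ i ∈ Finset.range k, β.rowLen i

/-- The corners of `μ`: the cells with no cell of `μ` after them in their row or their column. -/
def corners (μ : YoungDiagram) : Finset (ℕ × ℕ) :=
  μ.cells.filter fun c => (c.1 + 1, c.2) ∉ μ ∧ (c.1, c.2 + 1) ∉ μ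

/-- The type of corners of `μ`; it indexes the predecessors of `μ`. -/
abbrev Corner (μ : YoungDiagram) : Type := {c : ℕ × ℕ // c ∈ corners μ}

/-- The predecessor of `μ` obtained by removing the corner `c`. -/
def pred (μ : YoungDiagram) (c : Corner μ) : YoungDiagram where
  cells := μ.cells.erase c.1
  isLowerSet := by
    obtain ⟨c, hc⟩ := c
    simp only [corners, Finset.mem_filter] at hc
    obtain ⟨-, h1, h2⟩ := hc
    intro a b hba ha
    simp only [Finset.coe_erase, Set.mem_sdiff, Finset.mem_coe, Set.mem_singleton_iff,
      YoungDiagram.mem_cells] at ha ⊢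
    refine ⟨μ.isLowerSet hba ha.1, ?_⟩
    rintro rfl
    rcases Prod.lt_iff.mp (lt_of_le_of_ne hba (Ne.symm ha.2)) with ⟨h, h'⟩ | ⟨h, h'⟩
    · exact h1 (μ.isLowerSet (show (b.1 + 1, b.2) ≤ a from ⟨h, h'⟩) ha.1)
    · exact h2 (μ.isLowerSet (show (b.1, b.2 + 1) ≤ a from ⟨h, h'⟩) ha.1)

/- ## Symmetric functions

In characteristic `0` the ring of symmetric functions over `F` is the polynomial ring
`F[p₁, p₂, …]` in the power sums; the variable `X k` is `pₖ`. -/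

/-- Symmetric functions with coefficients in `F`. -/
abbrev SymFun (F : Type) [Field F] : Type := MvPolynomial ℕ+ F

section Generic

variable {F : Type} [Field F]

/-- The power sum `pₖ`, for `k ≥ 1`. -/
def psum (k : ℕ) : SymFun F := MvPolynomial.X k.toPNat'

/-- `p_{λ(σ)}`, where `λ(σ)` is the partition of `n` given by all cycle lengths of `σ`
(fixed points included). -/
def psumOfPerm {n : ℕ} (σ : Equiv.Perm (Fin n)) : SymFun F := (σ.partition.parts.map psum).prod

/-- The complete homogeneous symmetric function `hₙ = (1/n!) ∑_{σ ∈ Sₙ} p_{λ(σ)}`. -/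
def hsymm (n : ℕ) : SymFun F :=
  (n.factorial : F)⁻¹ • ∑ σ : Equiv.Perm (Fin n), psumOfPerm σ

/-- `h_z` for an integer index, with `h_z = 0` for `z < 0`. -/
def hsymmInt (z : ℤ) : SymFun F := if z < 0 then 0 else hsymm z.toNat

/-- The Schur function `S_α = det (h_{αᵢ - i + j})`, of size the number of rows of `α`. -/
def schur (α : YoungDiagram) : SymFun F :=
  Matrix.det (Matrix.of fun i j : Fin (α.colLen 0) =>
    (hsymmInt ((α.rowLen i : ℤ) - (i : ℕ) + (j : ℕ)) : SymFun F))

/-- `⟨p_d, p_d⟩ = z_d p_d[(1 - a)/(1 - b)]`, where `d k` is the multiplicity of the part `k`. -/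
def powerNorm (a b : F) (d : ℕ+ →₀ ℕ) : F :=
  d.prod fun k j =>
    ((k : ℕ) : F) ^ j * (j.factorial : F) * ((1 - a ^ (k : ℕ)) / (1 - b ^ (k : ℕ))) ^ j

/-- The Macdonald scalar product with parameters `a, b` (usually called `q, t`): the power basis
is orthogonal and `⟨p_d, p_d⟩ = powerNorm a b d`. -/
def scalarProd (a b : F) (f g : SymFun F) : F :=
  ∑ d ∈ f.support, f.coeff d * g.coeff d * powerNorm a b d

/-- `P` is, in degree `n`, the Macdonald basis `P_α(x; a, b)`: it is unitriangular in the Schur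
basis for the dominance order and orthogonal for the Macdonald scalar product. -/
def IsMacdonaldFamily (a b : F) (n : ℕ) (P : YoungDiagram → SymFun F) : Prop :=
  (∀ α : YoungDiagram, α.card = n →
      P α - schur α ∈ Submodule.span F {s : SymFun F | ∃ β, DomLT β α ∧ s = schur β}) ∧
  ∀ α β : YoungDiagram, α.card = n → β.card = n → α ≠ β → scalarProd a b (P α) (P β) = 0

open scoped Classical in
/-- The Macdonald polynomial `P_α(x; a, b)`, by its characterization. -/
def macdonaldP (a b : F) (α : YoungDiagram) : SymFun F :=
  if h : ∃ P : YoungDiagram → SymFun F, IsMacdonaldFamily a b α.card P then h.choose α else 0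

/-- The integral form `J_α(x; a, b) = ∏_{s ∈ α} (1 - a^{arm s} b^{leg s + 1}) P_α(x; a, b)`. -/
def macdonaldJ (a b : F) (α : YoungDiagram) : SymFun F :=
  (∏ c ∈ α.cells, (1 - a ^ arm α c * b ^ (leg α c + 1))) • macdonaldP a b α

/-- The plethystic substitution `f ↦ f[X/(1 - b)]`, i.e. `pₖ ↦ pₖ/(1 - bᵏ)`. -/
def plethDiv (b : F) : SymFun F →ₐ[F] SymFun F :=
  MvPolynomial.aeval fun k : ℕ+ => ((1 - b ^ (k : ℕ))⁻¹ : F) • (MvPolynomial.X k : SymFun F)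

/-- `H_α(x; a, b) = J_α[X/(1 - b); a, b]`. -/
def macdonaldH (a b : F) (α : YoungDiagram) : SymFun F := plethDiv b (macdonaldJ a b α)

end Generic

/-- The coefficient field `ℚ(q, t)`. -/
abbrev K : Type := FractionRing (MvPolynomial (Fin 2) ℚ)

/-- The parameter `q`. -/
def q : K := algebraMap (MvPolynomial (Fin 2) ℚ) K (MvPolynomial.X 0)

/-- The parameter `t`. -/
def t : K := algebraMap (MvPolynomial (Fin 2) ℚ) K (MvPolynomial.X 1)

/-- The modified Macdonald polynomial `H̃_α(x; q, t) = t^{n(α)} H_α(x; q, 1/t)`. -/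
def Htilde (α : YoungDiagram) : SymFun K := t ^ nStat α • macdonaldH q t⁻¹ α

/-- `T_α = ∏_{(i, j) ∈ α} t^i q^j`, with rows and columns counted from `0`. -/
def T (α : YoungDiagram) : K := ∏ c ∈ α.cells, t ^ c.1 * q ^ c.2

open scoped Classical in
/-- The operator `∇`: the linear automorphism of the symmetric functions that has the
modified Macdonald basis as eigenvectors, `∇ H̃_α = T_α H̃_α` for all partitions `α`. -/
def nabla : SymFun K ≃ₗ[K] SymFun K :=
  if h : ∃ N : SymFun K ≃ₗ[K] SymFun K, ∀ α : YoungDiagram, N (Htilde α) = T α • Htilde α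
  then h.choose else LinearEquiv.refl K (SymFun K)

/- ## Bigraded `Sₙ`-modules of polynomials in `x₁, …, xₙ, y₁, …, yₙ` -/

/-- Polynomials in `x₁, …, xₙ` (the variables `inl i`) and `y₁, …, yₙ` (the variables `inr i`). -/
abbrev XYPoly (n : ℕ) : Type := MvPolynomial (Fin n ⊕ Fin n) ℚ

/-- The diagonal action `σ P(x; y) = P(x_{σ₁}, …, x_{σₙ}; y_{σ₁}, …, y_{σₙ})`. -/
def act {n : ℕ} (σ : Equiv.Perm (Fin n)) : XYPoly n →ₗ[ℚ] XYPoly n :=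
  (MvPolynomial.rename (Sum.map σ σ)).toLinearMap

/-- The polynomials that are bihomogeneous of degree `d.1` in `x` and `d.2` in `y`. -/
def bihom (n : ℕ) (d : ℕ × ℕ) : Submodule ℚ (XYPoly n) :=
  MvPolynomial.weightedHomogeneousSubmodule ℚ
    (Sum.elim (fun _ => ((1, 0) : ℕ × ℕ)) (fun _ => ((0, 1) : ℕ × ℕ))) d

/-- The operator `∂_x^p ∂_y^r`, where `d` is the pair of exponent vectors `(p, r)`. -/
def diffMonomial {n : ℕ} (d : (Fin n ⊕ Fin n) →₀ ℕ) : Module.End ℚ (XYPoly n) :=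
  (List.ofFn fun i : Fin n =>
    ((MvPolynomial.pderiv (R := ℚ) (Sum.inl i : Fin n ⊕ Fin n)).toLinearMap :
      Module.End ℚ (XYPoly n)) ^ d (Sum.inl i)).prod *
  (List.ofFn fun i : Fin n =>
    ((MvPolynomial.pderiv (R := ℚ) (Sum.inr i : Fin n ⊕ Fin n)).toLinearMap :
      Module.End ℚ (XYPoly n)) ^ d (Sum.inr i)).prod

/-- The linear map `P ↦ P(∂) Δ`. -/
def flipMap {n : ℕ} (Δ : XYPoly n) : XYPoly n →ₗ[ℚ] XYPoly n :=
  (MvPolynomial.basisMonomials (Fin n ⊕ Fin n) ℚ).constr ℚ fun d => diffMonomial d Δ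

/-- The `j`-th cell (from `0`) of `α` in lexicographic order. -/
def cellAt (α : YoungDiagram) (j : ℕ) : ℕ × ℕ :=
  ofLex (((α.cells.map toLex.toEmbedding).sort (· ≤ ·)).getD j (toLex (0, 0)))

/-- `Δ_α(x; y) = det (xᵢ^{pⱼ} yᵢ^{rⱼ})`, where `(pⱼ, rⱼ)` are the cells of the partition `α`
of `n`. -/
def Delta (n : ℕ) (α : YoungDiagram) : XYPoly n :=
  Matrix.det (Matrix.of fun i j : Fin n =>
    (MvPolynomial.X (Sum.inl i) ^ (cellAt α j).1 *
      MvPolynomial.X (Sum.inr i) ^ (cellAt α j).2 : XYPoly n))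

/-- The Garsia–Haiman module `M_α`, for a partition `α` of `n`: the span of all partial
derivatives of `Δ_α`. -/
def GHModule (n : ℕ) (α : YoungDiagram) : Submodule ℚ (XYPoly n) :=
  Submodule.span ℚ (Set.range fun d => diffMonomial d (Delta n α))

open scoped Classical in
/-- The trace of `σ` on a subspace `W` that it maps into itself. -/
def traceOn {n : ℕ} (σ : Equiv.Perm (Fin n)) (W : Submodule ℚ (XYPoly n)) : ℚ :=
  if h : ∀ x ∈ W, act σ x ∈ W then LinearMap.trace ℚ W ((act σ).restrict h) else 0

/-- The bigraded character `∑_{h, k} t^h q^k char(W_{h, k})` at `σ`. -/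
def bigradedChar {n : ℕ} (W : Submodule ℚ (XYPoly n)) (σ : Equiv.Perm (Fin n)) : K :=
  ∑ᶠ d : ℕ × ℕ, algebraMap ℚ K (traceOn σ (W ⊓ bihom n d)) * (t ^ d.1 * q ^ d.2)

/-- The bivariate Frobenius characteristic of a (finite-dimensional, bigraded, `Sₙ`-invariant)
space of polynomials. -/
def frob {n : ℕ} (W : Submodule ℚ (XYPoly n)) : SymFun K :=
  (n.factorial : K)⁻¹ • ∑ σ : Equiv.Perm (Fin n), bigradedChar W σ • psumOfPerm σ

/-- `W ≅ W'` as bigraded `Sₙ`-modules. -/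
def BigradedIso {n : ℕ} (W W' : Submodule ℚ (XYPoly n)) : Prop :=
  ∃ e : W ≃ₗ[ℚ] W',
    (∀ (σ : Equiv.Perm (Fin n)) (x y : W), (y : XYPoly n) = act σ x →
      (e y : XYPoly n) = act σ (e x)) ∧
    ∀ (d : ℕ × ℕ) (x : W), (x : XYPoly n) ∈ bihom n d → (e x : XYPoly n) ∈ bihom n d

/- ## The heuristic

A `0`-`1` word indexed by the corners of `μ` is given as the set `S` of the corners where the
letter is `1`. -/

variable {n : ℕ} {μ : YoungDiagram}

/-- `M^{=S}`: the span of the elements of `B` that lie in `Bᵢ` for exactly the `i ∈ S`. -/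
def part (B : Set (XYPoly n)) (Bi : Corner μ → Set (XYPoly n)) (S : Finset (Corner μ)) :
    Submodule ℚ (XYPoly n) :=
  Submodule.span ℚ {b | b ∈ B ∧ ∀ i, b ∈ Bi i ↔ i ∈ S}

/-- `B`, with its subsets `Bᵢ`, is a basis of `∑ᵢ M_{α(i)}` as in the "science fiction"
heuristic for `μ`, a partition of `n + 1`. -/
structure IsSFBasis (B : Set (XYPoly n)) (Bi : Corner μ → Set (XYPoly n)) : Prop where
  bihomogeneous : ∀ b ∈ B, ∃ d, b ∈ bihom n d
  linearIndependent : LinearIndependent ℚ (fun b : B => (b : XYPoly n))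
  span_eq : Submodule.span ℚ B = ⨆ i : Corner μ, GHModule n (pred μ i)
  subset : ∀ i, Bi i ⊆ B
  span_part_eq : ∀ i, Submodule.span ℚ (Bi i) = GHModule n (pred μ i)
  /-- Every `M^{=S}` is `Sₙ`-invariant. -/
  invariant : ∀ (S : Finset (Corner μ)) (σ : Equiv.Perm (Fin n)),
    ∀ x ∈ part B Bi S, act σ x ∈ part B Bi S
  /-- For `i ∈ S`, the flip in `M_{α(i)}` carries `M^{=S}` to an isomorphic copy of the part whose
  word is obtained by complementing every letter but the `i`-th. -/
  flip_iso : ∀ (S : Finset (Corner μ)), ∀ i ∈ S,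
    BigradedIso ((part B Bi S).map (flipMap (Delta n (pred μ i)))) (part B Bi (insert i Sᶜ))

variable (μ)

/-- `e_j[1/T₁ + ⋯ + 1/T_m]`, the `j`-th elementary symmetric function of the `1/T_{α(i)}`. -/
def eInvT (j : ℕ) : K := ((Finset.univ : Finset (Corner μ)).val.map fun i => (T (pred μ i))⁻¹).esymm j

/-- `Φ_μ = ∑_j (∏_{s ≠ j} 1/(1 - T_j/T_s)) H̃_{α(j)}`. -/
def PhiMu : SymFun K :=
  ∑ j : Corner μ, (∏ s ∈ Finset.univ.erase j, (1 - T (pred μ j) / T (pred μ s))⁻¹) •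
    Htilde (pred μ j)

variable {μ}

/-- `Φ 1, …, Φ m` are the symmetric functions `Φ^{(1)}, …, Φ^{(m)}` attached to `B`: for every
nonempty `S` the Frobenius characteristic of `M^{=S}` is `Φ^{(|S|)} / ∏_{i ∉ S} T_i`. This
determines `Φ k` for `1 ≤ k ≤ m`. -/
def IsPhi (B : Set (XYPoly n)) (Bi : Corner μ → Set (XYPoly n)) (Φ : ℕ → SymFun K) : Prop :=
  ∀ S : Finset (Corner μ), S.Nonempty →
    frob (part B Bi S) = (∏ i ∈ Sᶜ, T (pred μ i))⁻¹ • Φ S.card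

end

end MacdonaldSF

open MacdonaldSF

/-! Over ℚ, the flip `P ↦ P(∂)Δ_α` is injective on `M_α`, because `P(∂)P` has positive constant term
unless `P = 0`. It turns bidegree `d` into `deg Δ_α - d` and twists the action by the sign, and
`T_α` is the monomial of `deg Δ_α`. Hence, for `i ∈ S`, the hypothesis on flips gives `M^{={i} ∪
Sᶜ}` the bigraded character `Tᵢ · c`, where `c` depends on `S` alone. With `S = Rᶜ`, the quotient `F
M^{={i} ∪ R} / Tᵢ` is the same for all `i ∉ R` (`frob_insert`). Exchanging one index at a time,
`(∏_{i ∉ S} Tᵢ) F M^{=S}` depends only on `|S|`, and this common value is `Φ^{(|S|)}`.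

The basis `B` splits into the parts, so Frobenius characteristics add (`frob_span`). With `xᵢ =
1/Tᵢ`, summing over all `S` gives the first formula, and summing over `S ∋ i` gives `H̃ᵢ = ∑ₖ
e_{m-k}[x without xᵢ] Φ^{(k)}`. The `xᵢ` are distinct, so Lagrange interpolation inverts this system
(`eq_sum_lagrangeWeight_smul`). Every combination of the `Φ^{(k)}` is then a combination of the
`H̃ᵢ`, on which `∇` is diagonal. The two remaining identities reduce to Vieta's relation at the root
`xᵢ`.

That `∇` exists is also proved: orthogonality for an anisotropic form makes the nonzero Macdonald
polynomials independent, so prescribed eigenvalues extend to an automorphism. -/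

namespace MacdonaldSF

/- ## Differential operators act as shifts on rescaled coefficients -/

section Shift

variable {σ : Type} [Fintype σ]

/-- `∏ᵢ eᵢ!`. -/
def expFactorial (e : σ →₀ ℕ) : ℚ := ∏ i, ((e i).factorial : ℚ)

lemma expFactorial_pos (e : σ →₀ ℕ) : 0 < expFactorial e :=
  Finset.prod_pos fun _ _ => by positivity

lemma expFactorial_add_single (e : σ →₀ ℕ) (i : σ) :
    expFactorial (e + Finsupp.single i 1) = (e i + 1) * expFactorial e := by
  classical
  unfold expFactorial
  rw [← Finset.mul_prod_erase _ _ (Finset.mem_univ i),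
    ← Finset.mul_prod_erase _ (fun j => ((e j).factorial : ℚ)) (Finset.mem_univ i), ← mul_assoc]
  congr 1
  · simp [Nat.factorial_succ]
  · refine Finset.prod_congr rfl fun j hj => ?_
    simp [(Finset.ne_of_mem_erase hj).symm]

/-- The operator `D` shifts the coefficients by `d`, after multiplying them by `e!`. -/
def IsShift (D : Module.End ℚ (MvPolynomial σ ℚ)) (d : σ →₀ ℕ) : Prop :=
  ∀ f e, (D f).coeff e * expFactorial e = f.coeff (e + d) * expFactorial (e + d)

lemma IsShift.one : IsShift (1 : Module.End ℚ (MvPolynomial σ ℚ)) 0 := fun f e => by simp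

lemma IsShift.mul {D D' : Module.End ℚ (MvPolynomial σ ℚ)} {d d' : σ →₀ ℕ}
    (h : IsShift D d) (h' : IsShift D' d') : IsShift (D * D') (d + d') := fun f e => by
  rw [Module.End.mul_apply, h, h', add_assoc]

lemma IsShift.pow {D : Module.End ℚ (MvPolynomial σ ℚ)} {d : σ →₀ ℕ}
    (h : IsShift D d) (k : ℕ) : IsShift (D ^ k) (k • d) := by
  induction k with
  | zero => simpa using IsShift.one
  | succ k ih => rw [pow_succ, succ_nsmul]; exact ih.mul h

lemma isShift_pderiv (i : σ) :
    IsShift (MvPolynomial.pderiv (R := ℚ) i).toLinearMap (Finsupp.single i 1) := fun f e => by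
  change (MvPolynomial.pderiv i f).coeff e * _ = _
  rw [MvPolynomial.coeff_pderiv, expFactorial_add_single]
  ring

lemma IsShift.ofFn_prod {n : ℕ} {D : Fin n → Module.End ℚ (MvPolynomial σ ℚ)}
    {d : Fin n → σ →₀ ℕ} (h : ∀ i, IsShift (D i) (d i)) :
    IsShift (List.ofFn D).prod (∑ i, d i) := by
  induction n with
  | zero => simpa using IsShift.one
  | succ n ih =>
    rw [List.ofFn_succ, List.prod_cons, Fin.sum_univ_succ]
    exact (h 0).mul (ih fun i => h i.succ)

end Shift

/-! ### The flip map and its injectivity on Garsia–Haiman modules -/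

variable {n : ℕ}

/-- Once coefficients are rescaled by `e!`, differentiation is a translation of exponents.
Commutation, bidegrees and equivariance are all read off from this. -/
lemma isShift_diffMonomial (d : (Fin n ⊕ Fin n) →₀ ℕ) : IsShift (diffMonomial d) d := by
  have hd : d = ∑ i : Fin n, d (Sum.inl i) • Finsupp.single (Sum.inl i) 1 +
      ∑ i : Fin n, d (Sum.inr i) • Finsupp.single (Sum.inr i) 1 := by
    conv_lhs => rw [← Finsupp.univ_sum_single d, Fintype.sum_sum_type]
    simp
  have := (IsShift.ofFn_prod fun i => (isShift_pderiv (Sum.inl i : Fin n ⊕ Fin n)).pow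
    (d (Sum.inl i))).mul (IsShift.ofFn_prod fun i =>
      (isShift_pderiv (Sum.inr i : Fin n ⊕ Fin n)).pow (d (Sum.inr i)))
  rw [← hd] at this
  exact this

lemma coeff_diffMonomial (d e : (Fin n ⊕ Fin n) →₀ ℕ) (f : XYPoly n) :
    (diffMonomial d f).coeff e = f.coeff (e + d) * (expFactorial (e + d) / expFactorial e) := by
  rw [← mul_div_assoc, ← isShift_diffMonomial d f e, mul_div_cancel_right₀ _ (expFactorial_pos e).ne']

lemma flipMap_apply (Δ P : XYPoly n) :
    flipMap Δ P = P.support.sum fun d => P.coeff d • diffMonomial d Δ := by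
  rw [flipMap, Module.Basis.constr_apply]
  rfl

lemma flipMap_monomial (Δ : XYPoly n) (d : (Fin n ⊕ Fin n) →₀ ℕ) (c : ℚ) :
    flipMap Δ (MvPolynomial.monomial d c) = c • diffMonomial d Δ := by
  have : MvPolynomial.monomial d c = c • MvPolynomial.basisMonomials (Fin n ⊕ Fin n) ℚ d := by
    simp [MvPolynomial.smul_monomial]
  rw [this, map_smul, flipMap, Module.Basis.constr_basis]

lemma diffMonomial_comm (d d' : (Fin n ⊕ Fin n) →₀ ℕ) (f : XYPoly n) :
    diffMonomial d (diffMonomial d' f) = diffMonomial d' (diffMonomial d f) := by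
  ext e
  rw [← mul_left_inj' (expFactorial_pos e).ne', isShift_diffMonomial, isShift_diffMonomial,
    isShift_diffMonomial, isShift_diffMonomial, add_right_comm]

lemma flipMap_comm (P Q Δ : XYPoly n) :
    flipMap (flipMap Δ Q) P = flipMap (flipMap Δ P) Q := by
  simp only [flipMap_apply, map_sum, map_smul, Finset.smul_sum]
  rw [Finset.sum_comm]
  refine Finset.sum_congr rfl fun d _ => Finset.sum_congr rfl fun d' _ => ?_
  rw [smul_comm, diffMonomial_comm]

lemma flipMap_zero_left (P : XYPoly n) : flipMap (0 : XYPoly n) P = 0 := by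
  simp [flipMap_apply]

/-- The constant term of `P(∂)P` is `∑ d! c_d²`, a sum of positive rationals over the support of
`P`. -/
lemma eq_zero_of_flipMap_self {P : XYPoly n} (h : flipMap P P = 0) : P = 0 := by
  have h0 : ∑ d ∈ P.support, P.coeff d * (P.coeff d * expFactorial d) = 0 := by
    have := congrArg (MvPolynomial.coeff 0) h
    rw [flipMap_apply, MvPolynomial.coeff_sum] at this
    simpa [coeff_diffMonomial, expFactorial] using this
  by_contra hP
  refine (Finset.sum_pos (fun d hd => ?_) (MvPolynomial.support_nonempty.mpr hP)).ne' h0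
  have := mul_self_pos.mpr (MvPolynomial.mem_support_iff.mp hd)
  rw [← mul_assoc]
  exact mul_pos this (expFactorial_pos d)

lemma range_flipMap (α : YoungDiagram) : LinearMap.range (flipMap (Delta n α)) = GHModule n α := by
  rw [flipMap, Module.Basis.constr_range]; rfl

/-- Write `P = Q(∂)Δ`. Then `P(∂)P = Q(∂)P(∂)Δ = 0`. -/
lemma flipMap_injOn_GHModule {α : YoungDiagram} {P : XYPoly n} (hP : P ∈ GHModule n α)
    (h : flipMap (Delta n α) P = 0) : P = 0 := by
  rw [← range_flipMap] at hP
  obtain ⟨Q, rfl⟩ := hP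
  apply eq_zero_of_flipMap_self
  rw [flipMap_comm, h, flipMap_zero_left]

instance finite_GHModule (α : YoungDiagram) : Module.Finite ℚ (GHModule n α) := by
  refine Module.Finite.span_of_finite ℚ ?_
  -- A derivative `∂^d Δ` is nonzero only if `d` lies below some exponent of `Δ`.
  refine ((((Delta n α).support.biUnion fun s => Finset.Iic s).finite_toSet.image
    fun d => diffMonomial d (Delta n α)).union (Set.finite_singleton 0)).subset ?_
  rintro _ ⟨d, rfl⟩
  by_cases h : diffMonomial d (Delta n α) = 0
  · exact Or.inr h
  · refine Or.inl ⟨d, ?_, rfl⟩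
    obtain ⟨e, he⟩ := MvPolynomial.ne_zero_iff.mp h
    rw [coeff_diffMonomial] at he
    simp only [Finset.coe_biUnion, Set.mem_iUnion, Finset.mem_coe, Finset.mem_Iic]
    exact ⟨e + d, MvPolynomial.mem_support_iff.mpr (left_ne_zero_of_mul he), by simp⟩

/- ## Bidegrees -/

/-- The bidegree of a monomial. -/
noncomputable abbrev bideg (e : (Fin n ⊕ Fin n) →₀ ℕ) : ℕ × ℕ :=
  Finsupp.weight (Sum.elim (fun _ => ((1, 0) : ℕ × ℕ)) (fun _ => ((0, 1) : ℕ × ℕ))) e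

lemma mem_bihom {d : ℕ × ℕ} {f : XYPoly n} :
    f ∈ bihom n d ↔ ∀ e, f.coeff e ≠ 0 → bideg e = d := by
  rw [bihom, MvPolynomial.mem_weightedHomogeneousSubmodule]
  exact ⟨fun h e he => h he, fun h e he => h e he⟩

/-- A surviving monomial `e` satisfies `bideg e + d = N`. Nonvanishing provides such an `e`, so the
truncated `N - d` is a true difference. -/
lemma flipMap_mem_bihom {N d : ℕ × ℕ} {Δ P : XYPoly n} (hΔ : Δ ∈ bihom n N) (hP : P ∈ bihom n d)
    (h0 : flipMap Δ P ≠ 0) : d ≤ N ∧ flipMap Δ P ∈ bihom n (N - d) := by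
  have key : ∀ e, (flipMap Δ P).coeff e ≠ 0 → bideg e + d = N := by
    intro e he
    rw [flipMap_apply, MvPolynomial.coeff_sum] at he
    obtain ⟨c, hc, hce⟩ := Finset.exists_ne_zero_of_sum_ne_zero he
    rw [MvPolynomial.coeff_smul, smul_eq_mul, coeff_diffMonomial] at hce
    rw [← mem_bihom.mp hP c (MvPolynomial.mem_support_iff.mp hc), ← map_add]
    exact mem_bihom.mp hΔ _ (left_ne_zero_of_mul (right_ne_zero_of_mul hce))
  obtain ⟨e, he⟩ := MvPolynomial.ne_zero_iff.mp h0
  refine ⟨key e he ▸ le_add_self, mem_bihom.mpr fun c hc => ?_⟩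
  rw [← key c hc, add_tsub_cancel_right]

/- ## The diagonal action -/

lemma expFactorial_mapDomain (s : Equiv.Perm (Fin n ⊕ Fin n)) (e : (Fin n ⊕ Fin n) →₀ ℕ) :
    expFactorial (e.mapDomain s) = expFactorial e := by
  unfold expFactorial
  rw [← Equiv.prod_comp s]
  simp [Finsupp.mapDomain_apply s.injective]

lemma act_eq_rename (σ : Equiv.Perm (Fin n)) (f : XYPoly n) :
    act σ f = MvPolynomial.rename (Equiv.sumCongr σ σ) f := rfl

lemma diffMonomial_act (σ : Equiv.Perm (Fin n)) (d : (Fin n ⊕ Fin n) →₀ ℕ) (f : XYPoly n) :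
    diffMonomial (d.mapDomain (Equiv.sumCongr σ σ)) (act σ f) = act σ (diffMonomial d f) := by
  ext e
  obtain ⟨e, rfl⟩ : ∃ c, e = Finsupp.mapDomain (Equiv.sumCongr σ σ) c :=
    ⟨e.mapDomain (Equiv.sumCongr σ σ).symm, by
      rw [← Finsupp.mapDomain_comp, ← Equiv.coe_trans, Equiv.symm_trans_self]
      exact Finsupp.mapDomain_id.symm⟩
  have hi := (Equiv.sumCongr σ σ).injective
  rw [coeff_diffMonomial, ← Finsupp.mapDomain_add, act_eq_rename, act_eq_rename,
    MvPolynomial.coeff_rename_mapDomain _ hi, MvPolynomial.coeff_rename_mapDomain _ hi,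
    coeff_diffMonomial, expFactorial_mapDomain, expFactorial_mapDomain]

lemma flipMap_act (σ : Equiv.Perm (Fin n)) (Δ P : XYPoly n) :
    flipMap (act σ Δ) (act σ P) = act σ (flipMap Δ P) := by
  induction P using MvPolynomial.induction_on' with
  | monomial d c =>
    have : act σ (MvPolynomial.monomial d c : XYPoly n) =
      MvPolynomial.monomial (d.mapDomain (Equiv.sumCongr σ σ)) c :=
        MvPolynomial.rename_monomial _ _ _
    rw [this, flipMap_monomial, flipMap_monomial, diffMonomial_act, map_smul]
  | add p r hp hr => simp only [map_add, hp, hr]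

lemma flipMap_smul_left (c : ℚ) (Δ P : XYPoly n) : flipMap (c • Δ) P = c • flipMap Δ P := by
  simp only [flipMap_apply, map_smul, Finset.smul_sum, smul_comm c]

/-- The action permutes the rows of the determinant. -/
lemma act_Delta (σ : Equiv.Perm (Fin n)) (α : YoungDiagram) :
    act σ (Delta n α) = ((Equiv.Perm.sign σ : ℤ) : ℚ) • Delta n α := by
  have h : act σ (Delta n α) = MvPolynomial.rename (Sum.map σ σ) (Delta n α) := rfl
  rw [h, Delta, AlgHom.map_det]
  have := Matrix.det_permute σ (Matrix.of fun i j : Fin n =>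
    (MvPolynomial.X (Sum.inl i) ^ (cellAt α j).1 *
      MvPolynomial.X (Sum.inr i) ^ (cellAt α j).2 : XYPoly n))
  rw [MvPolynomial.smul_eq_C_mul]
  convert this using 2
  · ext i j : 2
    simp
  · simp

lemma flipMap_Delta_act (σ : Equiv.Perm (Fin n)) (α : YoungDiagram) (P : XYPoly n) :
    act σ (flipMap (Delta n α) P) =
      ((Equiv.Perm.sign σ : ℤ) : ℚ) • flipMap (Delta n α) (act σ P) := by
  rw [← flipMap_act, act_Delta, flipMap_smul_left]

/-- The bidegree of `Δ_α`. -/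
def cellSum (α : YoungDiagram) : ℕ × ℕ := ∑ c ∈ α.cells, c

lemma sum_cellAt {α : YoungDiagram} (hα : α.card = n) : ∑ j : Fin n, cellAt α j = cellSum α := by
  set l := (α.cells.map toLex.toEmbedding).sort (· ≤ ·) with hl
  have hlen : l.length = n := by rw [hl, Finset.length_sort, Finset.card_map]; exact hα
  have h1 : cellSum α = (l.map ofLex).sum := by
    have : (↑(l.map ofLex) : Multiset (ℕ × ℕ)) = α.cells.val := by
      rw [← Multiset.map_coe, hl, Finset.sort_eq]
      simp [Function.comp_def]
    rw [← Multiset.sum_coe, this, cellSum, Finset.sum, Multiset.map_id']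
  rw [h1, ← List.sum_ofFn]
  congr 1
  apply List.ext_getElem
  · simp [hlen]
  · intro j hj hj'
    have : j < l.length := by simpa using hj'
    simp [cellAt, ← hl, List.getElem?_eq_getElem this]

lemma Delta_mem_bihom {α : YoungDiagram} (hα : α.card = n) :
    Delta n α ∈ bihom n (cellSum α) := by
  rw [Delta, Matrix.det_apply, ← sum_cellAt hα]
  refine Submodule.sum_mem _ fun σ _ => ?_
  rw [Units.smul_def]
  refine zsmul_mem ?_ _
  rw [bihom, MvPolynomial.mem_weightedHomogeneousSubmodule]
  refine MvPolynomial.IsWeightedHomogeneous.prod _ _ _ fun j _ => ?_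
  have h := ((MvPolynomial.isWeightedHomogeneous_X ℚ (Sum.elim (fun _ => ((1, 0) : ℕ × ℕ))
    (fun _ => ((0, 1) : ℕ × ℕ))) (Sum.inl (σ j) : Fin n ⊕ Fin n)).pow (cellAt α j).1).mul
    ((MvPolynomial.isWeightedHomogeneous_X ℚ (Sum.elim (fun _ => ((1, 0) : ℕ × ℕ))
    (fun _ => ((0, 1) : ℕ × ℕ))) (Sum.inr (σ j) : Fin n ⊕ Fin n)).pow (cellAt α j).2)
  simpa using h

lemma act_mem_bihom (σ : Equiv.Perm (Fin n)) {d : ℕ × ℕ} {f : XYPoly n} (hf : f ∈ bihom n d) :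
    act σ f ∈ bihom n d := by
  rw [mem_bihom] at *
  intro e he
  rw [act_eq_rename] at he
  obtain ⟨c, rfl, hc⟩ := MvPolynomial.coeff_rename_ne_zero _ _ _ he
  rw [← hf c hc]
  simp only [bideg, Finsupp.weight_apply]
  rw [Finsupp.sum_mapDomain_index (by simp) (by simp [add_smul])]
  refine Finsupp.sum_congr fun i _ => ?_
  cases i <;> simp

/- ## Bigraded characters from bihomogeneous bases -/

section Character

variable {n : ℕ}

lemma traceOn_span {κ : Type*} [Fintype κ] {w : κ → XYPoly n} (hw : LinearIndependent ℚ w)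
    {σ : Equiv.Perm (Fin n)} {A : κ → κ → ℚ} (hA : ∀ j, act σ (w j) = ∑ i, A i j • w i) :
    traceOn σ (Submodule.span ℚ (Set.range w)) = ∑ j, A j j := by
  classical
  have hinv : ∀ x ∈ Submodule.span ℚ (Set.range w),
      act σ x ∈ Submodule.span ℚ (Set.range w) := by
    intro x hx
    have : Submodule.span ℚ (Set.range w) ≤
        (Submodule.span ℚ (Set.range w)).comap (act σ) := by
      rw [Submodule.span_le]
      rintro _ ⟨j, rfl⟩
      simp only [SetLike.mem_coe, Submodule.mem_comap, hA]
      exact Submodule.sum_mem _ fun i _ =>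
        Submodule.smul_mem _ _ (Submodule.subset_span ⟨i, rfl⟩)
    exact this hx
  rw [traceOn, dif_pos hinv, LinearMap.trace_eq_matrix_trace ℚ (Module.Basis.span hw),
    Matrix.trace]
  refine Finset.sum_congr rfl fun j _ => ?_
  rw [Matrix.diag_apply, LinearMap.toMatrix_apply]
  have : ((act σ).restrict hinv) (Module.Basis.span hw j) =
      ∑ i, A i j • Module.Basis.span hw i := by
    apply Subtype.ext
    simp [Module.Basis.span_apply, hA]
  rw [this, map_sum, Finset.sum_apply']
  simp only [map_smul, Module.Basis.repr_self, Finsupp.smul_single, smul_eq_mul, mul_one,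
    Finsupp.single_apply]
  simp

/-- If `deg i ≠ d`, the component of the sum in bidegree `deg i` vanishes. It is a combination of
the `v k` of that bidegree, so independence kills `c i`. -/
lemma deg_eq_of_sum_mem_bihom {ι : Type*} [Fintype ι] {v : ι → XYPoly n}
    (hv : LinearIndependent ℚ v) {deg : ι → ℕ × ℕ} (hd : ∀ i, v i ∈ bihom n (deg i))
    {c : ι → ℚ} {d : ℕ × ℕ} (h : ∑ i, c i • v i ∈ bihom n d) {i : ι} (hi : c i ≠ 0) :
    deg i = d := by
  classical
  by_contra hne
  refine hi ?_
  have h0 : ∑ k, (if deg k = deg i then c k else 0) • v k = 0 := by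
    ext e
    rw [MvPolynomial.coeff_sum, MvPolynomial.coeff_zero]
    by_cases he : bideg e = deg i
    · have : (∑ k, c k • v k).coeff e = 0 := by
        by_contra h'
        exact hne (he.symm.trans (mem_bihom.mp h e h'))
      rw [MvPolynomial.coeff_sum] at this
      rw [← this]
      refine Finset.sum_congr rfl fun k _ => ?_
      split_ifs with hk
      · rfl
      · have : (v k).coeff e = 0 := by
          by_contra h'
          exact hk ((mem_bihom.mp (hd k) e h').symm.trans he)
        simp [this]
    · refine Finset.sum_eq_zero fun k _ => ?_
      split_ifs with hk
      · have : (v k).coeff e = 0 := by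
          by_contra h'
          exact he ((mem_bihom.mp (hd k) e h').trans hk)
        simp [this]
      · simp
  simpa using Fintype.linearIndependent_iff.mp hv _ h0 i

lemma span_inf_bihom {ι : Type*} [Finite ι] {v : ι → XYPoly n}
    (hv : LinearIndependent ℚ v) {deg : ι → ℕ × ℕ} (hd : ∀ i, v i ∈ bihom n (deg i))
    (d : ℕ × ℕ) :
    Submodule.span ℚ (Set.range v) ⊓ bihom n d =
      Submodule.span ℚ (Set.range fun i : {i // deg i = d} => v i) := by
  have := Fintype.ofFinite ι
  apply le_antisymm
  · rintro x ⟨hx, hxd⟩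
    obtain ⟨c, rfl⟩ := (Submodule.mem_span_range_iff_exists_fun ℚ).mp hx
    refine Submodule.sum_mem _ fun i _ => ?_
    by_cases hi : c i = 0
    · simp [hi]
    · exact Submodule.smul_mem _ _ (Submodule.subset_span
        ⟨⟨i, deg_eq_of_sum_mem_bihom hv hd hxd hi⟩, rfl⟩)
  · rw [Submodule.span_le]
    rintro _ ⟨⟨i, hi⟩, rfl⟩
    exact ⟨Submodule.subset_span ⟨i, rfl⟩, hi ▸ hd i⟩

/-- The monomial `t^h q^k` attached to the bidegree `(h, k)`. -/
noncomputable def tqPow (d : ℕ × ℕ) : K := t ^ d.1 * q ^ d.2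

lemma bigradedChar_span {ι : Type*} [Fintype ι] {v : ι → XYPoly n}
    (hv : LinearIndependent ℚ v) {deg : ι → ℕ × ℕ} (hd : ∀ i, v i ∈ bihom n (deg i))
    {σ : Equiv.Perm (Fin n)} {A : ι → ι → ℚ} (hA : ∀ j, act σ (v j) = ∑ i, A i j • v i) :
    bigradedChar (Submodule.span ℚ (Set.range v)) σ =
      ∑ j, algebraMap ℚ K (A j j) * tqPow (deg j) := by
  classical
  have htr : ∀ d, traceOn σ (Submodule.span ℚ (Set.range v) ⊓ bihom n d) =
      ∑ j : {i // deg i = d}, A j j := by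
    intro d
    rw [span_inf_bihom hv hd]
    refine traceOn_span (hv.comp _ Subtype.val_injective)
      (A := fun i j : {i // deg i = d} => A i j) fun j => ?_
    simp only [Function.comp_apply]
    rw [hA]
    -- The action preserves bidegree, so `A` is block diagonal along the fibres of `deg`.
    have hdeg : ∀ i, A i j ≠ 0 → deg i = d := fun i hi =>
      (deg_eq_of_sum_mem_bihom hv hd (d := deg j) (c := fun i => A i j)
        (hA j ▸ act_mem_bihom σ (hd j)) hi).trans j.2
    rw [← Finset.sum_filter_of_ne (p := fun i => deg i = d) fun i _ hi =>
      hdeg i (left_ne_zero_of_smul hi)]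
    exact (Finset.sum_subtype _ (by simp) _)
  simp only [bigradedChar, htr]
  rw [finsum_eq_sum_of_support_subset (s := Finset.univ.image deg)]
  · rw [← Finset.sum_fiberwise_of_maps_to (g := deg) (t := Finset.univ.image deg)
      fun i _ => Finset.mem_image_of_mem _ (Finset.mem_univ i)]
    refine Finset.sum_congr rfl fun d _ => ?_
    rw [map_sum, Finset.sum_mul, Finset.sum_subtype (p := fun i => deg i = d) _ (by simp)]
    refine Finset.sum_congr rfl fun j _ => ?_
    rw [tqPow, j.2]
  · intro d hd'
    by_contra hne
    refine hd' ?_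
    have : IsEmpty {i // deg i = d} :=
      ⟨fun i => hne (by simpa using ⟨i.1, i.2⟩)⟩
    simp

end Character

/-! ### Characters of the parts `M^{=S}` and the exchange of indices -/

section Pieces

variable {n : ℕ} {μ : YoungDiagram} {B : Set (XYPoly n)} {Bi : Corner μ → Set (XYPoly n)}

lemma card_pred (hμ : μ.card = n + 1) (i : Corner μ) : (pred μ i).card = n := by
  have hi : i.1 ∈ μ.cells := (Finset.mem_filter.mp i.2).1
  change (μ.cells.erase i.1).card = n
  rw [Finset.card_erase_of_mem hi]
  exact Nat.sub_eq_of_eq_add hμ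

lemma q_ne_zero : q ≠ 0 := by
  simp [q]

lemma t_ne_zero : t ≠ 0 := by
  simp [t]

lemma T_ne_zero (α : YoungDiagram) : T α ≠ 0 :=
  Finset.prod_ne_zero_iff.mpr fun _ _ =>
    mul_ne_zero (pow_ne_zero _ t_ne_zero) (pow_ne_zero _ q_ne_zero)

lemma T_eq_tqPow (α : YoungDiagram) : T α = tqPow (cellSum α) := by
  simp only [T, tqPow, cellSum, Prod.fst_sum, Prod.snd_sum, Finset.prod_mul_distrib,
    Finset.prod_pow_eq_pow_sum]

lemma tqPow_sub {N d : ℕ × ℕ} (h : d ≤ N) : tqPow (N - d) = tqPow N * (tqPow d)⁻¹ := by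
  have h1 : tqPow d ≠ 0 := mul_ne_zero (pow_ne_zero _ t_ne_zero) (pow_ne_zero _ q_ne_zero)
  rw [eq_mul_inv_iff_mul_eq₀ h1]
  simp only [tqPow, Prod.fst_sub, Prod.snd_sub]
  rw [mul_mul_mul_comm, ← pow_add, ← pow_add, Nat.sub_add_cancel h.1, Nat.sub_add_cancel h.2]


/-- Invariance forces `A i j = 0` when `p j` holds and `p i` fails. The block of `A` on `p` is
therefore the matrix of the action on the subspace. -/
lemma bigradedChar_span_image {ι : Type*} [Fintype ι] {v : ι → XYPoly n}
    (hv : LinearIndependent ℚ v) {deg : ι → ℕ × ℕ} (hd : ∀ i, v i ∈ bihom n (deg i))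
    {σ : Equiv.Perm (Fin n)} {A : ι → ι → ℚ} (hA : ∀ j, act σ (v j) = ∑ i, A i j • v i)
    (p : ι → Prop) [DecidablePred p]
    (hp : ∀ j, p j → act σ (v j) ∈ Submodule.span ℚ (v '' {i | p i})) :
    bigradedChar (Submodule.span ℚ (v '' {i | p i})) σ =
      ∑ j with p j, algebraMap ℚ K (A j j) * tqPow (deg j) := by
  have hz : ∀ i j, p j → A i j ≠ 0 → p i := by
    intro i j hj hi
    obtain ⟨l, hl, hlj⟩ := (Finsupp.mem_span_image_iff_linearCombination ℚ).mp (hp j hj)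
    have : l = Finsupp.equivFunOnFinite.symm fun i => A i j := by
      refine hv ?_
      rw [hlj, hA, Finsupp.linearCombination_apply, Finsupp.sum_fintype _ _ (by simp)]
      rfl
    exact (Finsupp.mem_supported ℚ l).mp hl (by simpa [this] using hi)
  have hr : v '' {i | p i} = Set.range fun i : {i // p i} => v i := by
    rw [Set.image_eq_range]; rfl
  rw [hr, bigradedChar_span (v := fun i : {i // p i} => v i) (deg := fun i : {i // p i} => deg i)
    (A := fun i j : {i // p i} => A i j) (hv.comp _ Subtype.val_injective) (fun i => hd i)]
  · exact (Finset.sum_subtype (Finset.univ.filter p) (by simp)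
      fun j => algebraMap ℚ K (A j j) * tqPow (deg j)).symm
  · intro j
    rw [hA, ← Finset.sum_filter_of_ne (p := p) fun i _ hi =>
      hz i j j.2 (left_ne_zero_of_smul hi)]
    exact (Finset.sum_subtype _ (by simp) _)

namespace IsSFBasis

lemma finite (h : IsSFBasis B Bi) : B.Finite := by
  have : Module.Finite ℚ (Submodule.span ℚ (Set.range fun b : B => (b : XYPoly n))) := by
    rw [Subtype.range_coe, h.span_eq]; infer_instance
  have hli := linearIndependent_span h.linearIndependent
  have : Finite B := hli.finite
  exact Set.toFinite B

open scoped Classical in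
/-- The set of indices `i` with `b ∈ Bᵢ`. -/
noncomputable def word (Bi : Corner μ → Set (XYPoly n)) (b : XYPoly n) : Finset (Corner μ) :=
  Finset.univ.filter fun i => b ∈ Bi i

lemma mem_word {b : XYPoly n} {i : Corner μ} : i ∈ word Bi b ↔ b ∈ Bi i := by simp [word]

lemma part_eq (S : Finset (Corner μ)) :
    part B Bi S = Submodule.span ℚ ((fun b : B => (b : XYPoly n)) '' {b | word Bi b = S}) := by
  rw [part]
  congr 1
  ext b
  simp only [Set.mem_ofPred_eq, Set.mem_image, Subtype.exists, exists_and_right, exists_eq_right,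
    Finset.ext_iff, mem_word]
  simp

/-- The `Bᵢ` together already span the whole space, so a basis element outside all of them would
depend on the others. -/
lemma word_nonempty (h : IsSFBasis B Bi) (b : B) : (word Bi b).Nonempty := by
  by_contra hne
  rw [Finset.not_nonempty_iff_eq_empty] at hne
  have hb : ∀ i, (b : XYPoly n) ∉ Bi i := fun i hi => by
    have := mem_word.mpr hi
    simp [hne] at this
  refine h.linearIndependent.notMem_span_image (s := {b}ᶜ) (x := b) (by simp) ?_
  have h1 : (b : XYPoly n) ∈ Submodule.span ℚ B := Submodule.subset_span b.2
  rw [h.span_eq] at h1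
  refine (iSup_le fun i => ?_ : (⨆ i, GHModule n (pred μ i)) ≤ _) h1
  rw [← h.span_part_eq i]
  refine Submodule.span_mono fun c hc => ⟨⟨c, h.subset i hc⟩, ?_, rfl⟩
  rintro rfl
  exact hb i hc

lemma act_mem_part (h : IsSFBasis B Bi) (σ : Equiv.Perm (Fin n)) (b : B) :
    act σ (b : XYPoly n) ∈ part B Bi (word Bi b) :=
  h.invariant _ σ _ (Submodule.subset_span ⟨b.2, fun _ => mem_word.symm⟩)

/-- Each element of the basis contributes a term to the bigraded character of every part
that contains it. -/
lemma exists_diag (h : IsSFBasis B Bi) [Fintype B] (σ : Equiv.Perm (Fin n)) :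
    ∃ g : B → K, ∀ p : Finset (Corner μ) → Prop, ∀ [DecidablePred p],
      bigradedChar (Submodule.span ℚ ((fun b : B => (b : XYPoly n)) '' {b | p (word Bi b)})) σ =
        ∑ b ∈ Finset.univ.filter fun b : B => p (word Bi b), g b := by
  choose deg hdeg using fun b : B => h.bihomogeneous b b.2
  have h1 (b : B) : act σ (b : XYPoly n) ∈
      Submodule.span ℚ (Set.range fun b : B => (b : XYPoly n)) := by
    have := h.act_mem_part σ b
    rw [part_eq] at this
    exact Submodule.span_mono (Set.image_subset_range _ _) this
  choose A hA using fun b => (Submodule.mem_span_range_iff_exists_fun ℚ).mp (h1 b)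
  refine ⟨fun b => algebraMap ℚ K (A b b) * tqPow (deg b), fun p _ =>
    bigradedChar_span_image (p := fun b => p (word Bi b)) (A := fun i j => A j i)
      h.linearIndependent hdeg (fun j => (hA j).symm) fun b hb => ?_⟩
  have := h.act_mem_part σ b
  rw [part_eq] at this
  refine Submodule.span_mono (Set.image_mono fun c hc => ?_) this
  rw [Set.mem_ofPred_eq] at hc ⊢
  rwa [hc]

lemma GHModule_eq (h : IsSFBasis B Bi) (i : Corner μ) : GHModule n (pred μ i) =
    Submodule.span ℚ ((fun b : B => (b : XYPoly n)) '' {b | i ∈ word Bi b}) := by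
  rw [← h.span_part_eq i]
  congr 1
  ext b
  simp only [Set.mem_image, Set.mem_ofPred_eq, mem_word, Subtype.exists, exists_and_left]
  simpa using fun hb => h.subset i hb

lemma iSup_eq (h : IsSFBasis B Bi) : ⨆ i, GHModule n (pred μ i) =
    Submodule.span ℚ ((fun b : B => (b : XYPoly n)) '' {b | (word Bi b).Nonempty}) := by
  rw [← h.span_eq]
  congr 1
  ext b
  simp only [Set.mem_image, Set.mem_ofPred_eq, Subtype.exists, exists_and_left]
  simpa using fun hb => h.word_nonempty ⟨b, hb⟩

/-- The Frobenius characteristic is additive on the decomposition into parts. -/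
lemma frob_span (h : IsSFBasis B Bi) (p : Finset (Corner μ) → Prop) [DecidablePred p] :
    frob (Submodule.span ℚ ((fun b : B => (b : XYPoly n)) '' {b | p (word Bi b)})) =
      ∑ S with p S, frob (part B Bi S) := by
  classical
  have := h.finite.fintype
  simp only [frob]
  rw [← Finset.smul_sum, Finset.sum_comm]
  congr 1
  refine Finset.sum_congr rfl fun σ _ => ?_
  rw [← Finset.sum_smul]
  congr 1
  obtain ⟨g, hg⟩ := h.exists_diag σ
  rw [hg]
  have h2 (S : Finset (Corner μ)) : bigradedChar (part B Bi S) σ =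
      ∑ b ∈ Finset.univ.filter fun b : B => word Bi b = S, g b := by
    rw [part_eq]; exact hg fun S' => S' = S
  simp only [h2]
  rw [← Finset.sum_fiberwise_of_maps_to (s := Finset.univ.filter fun b : B => p (word Bi b))
    (g := fun b : B => word Bi b) (t := Finset.univ.filter p) (by simp)]
  refine Finset.sum_congr rfl fun S hS => Finset.sum_congr ?_ fun _ _ => rfl
  ext b
  simp only [Finset.mem_filter, Finset.mem_univ, true_and] at hS ⊢
  exact ⟨fun hb => hb.2, fun hb => ⟨hb ▸ hS, hb⟩⟩

/-- The flip identity `F(flip_α W) = T_α ω ↓F(W)` on a part, read on characters. -/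
lemma bigradedChar_insert_compl (h : IsSFBasis B Bi) (hμ : μ.card = n + 1)
    (S : Finset (Corner μ)) (σ : Equiv.Perm (Fin n)) :
    ∃ c : K, ∀ i ∈ S, bigradedChar (part B Bi (insert i Sᶜ)) σ = T (pred μ i) * c := by
  classical
  have := h.finite.fintype
  choose deg hdeg using fun b : B => h.bihomogeneous b b.2
  let ι := {b : B // word Bi b = S}
  let v : ι → XYPoly n := fun b => b.1
  have hv : LinearIndependent ℚ v := h.linearIndependent.comp _ Subtype.val_injective
  have hpart : part B Bi S = Submodule.span ℚ (Set.range v) := by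
    rw [part_eq, Set.image_eq_range]; rfl
  have hact (b : ι) : act σ (v b) ∈ Submodule.span ℚ (Set.range v) := by
    have := h.act_mem_part σ b.1
    rwa [b.2, hpart] at this
  choose A hA using fun b => (Submodule.mem_span_range_iff_exists_fun ℚ).mp (hact b)
  -- The witness is the sign-twisted character of `M^{=S}` with `t, q` inverted; `i` does not enter.
  refine ⟨∑ b, algebraMap ℚ K (((Equiv.Perm.sign σ : ℤ) : ℚ) * A b b) * (tqPow (deg b.1))⁻¹,
    fun i hi => ?_⟩
  set Δ := Delta n (pred μ i) with hΔ
  have hΔd : Δ ∈ bihom n (cellSum (pred μ i)) := Delta_mem_bihom (card_pred hμ i)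
  have hle : part B Bi S ≤ GHModule n (pred μ i) := by
    rw [h.GHModule_eq, part_eq]
    refine Submodule.span_mono (Set.image_mono fun b hb => ?_)
    rw [Set.mem_ofPred_eq] at hb ⊢
    rwa [hb]
  have hker {P : XYPoly n} (hP : P ∈ part B Bi S) (h0 : flipMap Δ P = 0) : P = 0 :=
    flipMap_injOn_GHModule (hle hP) h0
  have hvmem (b : ι) : v b ∈ part B Bi S := hpart ▸ Submodule.subset_span ⟨b, rfl⟩
  have hfv : LinearIndependent ℚ fun b => flipMap Δ (v b) := by
    refine hv.map (f := flipMap Δ) ?_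
    rw [← hpart, Submodule.disjoint_def]
    exact fun P hP h0 => hker hP h0
  have hne (b : ι) : flipMap Δ (v b) ≠ 0 := fun h0 => hv.ne_zero b (hker (hvmem b) h0)
  obtain ⟨e, he1, he2⟩ := h.flip_iso S i hi
  let w : ι → (part B Bi S).map (flipMap Δ) :=
    fun b => ⟨flipMap Δ (v b), Submodule.mem_map_of_mem (hvmem b)⟩
  have hw : Submodule.span ℚ (Set.range w) = ⊤ := by
    rw [eq_top_iff]
    rintro ⟨x, hx⟩ -
    obtain ⟨y, hy, rfl⟩ := Submodule.mem_map.mp hx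
    rw [hpart] at hy
    obtain ⟨c, rfl⟩ := (Submodule.mem_span_range_iff_exists_fun ℚ).mp hy
    rw [Submodule.mem_span_range_iff_exists_fun ℚ]
    exact ⟨c, Subtype.ext (by simp [w])⟩
  let v' : ι → XYPoly n := fun b => e (w b)
  have hv' : LinearIndependent ℚ v' := by
    have h1 : LinearIndependent ℚ w := LinearIndependent.of_comp (Submodule.subtype _) hfv
    exact ((h1.map' e.toLinearMap e.ker).map' (Submodule.subtype _) (Submodule.ker_subtype _))
  have hpart' : part B Bi (insert i Sᶜ) = Submodule.span ℚ (Set.range v') := by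
    have : Set.range v' = (fun x => ((e x : part B Bi (insert i Sᶜ)) : XYPoly n)) '' Set.range w :=
      Set.range_comp (fun x => ((e x : part B Bi (insert i Sᶜ)) : XYPoly n)) w
    have h2 := Submodule.map_span ((Submodule.subtype _).comp e.toLinearMap) (Set.range w)
    rw [hw, Submodule.map_top, LinearMap.range_comp, LinearEquiv.range, Submodule.map_top,
      Submodule.range_subtype] at h2
    rw [this]
    exact h2
  rw [hpart', bigradedChar_span (deg := fun b => cellSum (pred μ i) - deg b.1)
    (A := fun a b => ((Equiv.Perm.sign σ : ℤ) : ℚ) * A b a) hv', Finset.mul_sum]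
  · refine Finset.sum_congr rfl fun b _ => ?_
    rw [tqPow_sub (flipMap_mem_bihom hΔd (hdeg b.1) (hne b)).1, ← T_eq_tqPow]
    ring
  · exact fun b => he2 _ _ (flipMap_mem_bihom hΔd (hdeg b.1) (hne b)).2
  · intro b
    -- The flip anticommutes with odd permutations, so the matrix of `σ` on the flipped basis is its
    -- sign times the original one.
    have h1 := he1 σ (w b) (∑ a, (((Equiv.Perm.sign σ : ℤ) : ℚ) * A b a) • w a) (by
      simp only [w, AddSubmonoidClass.coe_finsetSum, SetLike.val_smul]
      rw [hΔ, flipMap_Delta_act, ← hA, map_sum, Finset.smul_sum]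
      simp only [map_smul, smul_smul])
    rw [← h1]
    simp [v']

/-- Both sides are flips of the same part, the one with word `Rᶜ`, which contains `i` and `j`. -/
lemma frob_insert (h : IsSFBasis B Bi) (hμ : μ.card = n + 1) (R : Finset (Corner μ))
    {i j : Corner μ} (hi : i ∉ R) (hj : j ∉ R) :
    (T (pred μ i))⁻¹ • frob (part B Bi (insert i R)) =
      (T (pred μ j))⁻¹ • frob (part B Bi (insert j R)) := by
  simp only [frob]
  rw [smul_comm (T (pred μ i))⁻¹ (n.factorial : K)⁻¹,
    smul_comm (T (pred μ j))⁻¹ (n.factorial : K)⁻¹]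
  congr 1
  rw [Finset.smul_sum, Finset.smul_sum]
  refine Finset.sum_congr rfl fun σ _ => ?_
  obtain ⟨c, hc⟩ := h.bigradedChar_insert_compl hμ Rᶜ σ
  rw [compl_compl] at hc
  rw [hc i (by simpa), hc j (by simpa), smul_smul, smul_smul,
    inv_mul_cancel_left₀ (T_ne_zero _), inv_mul_cancel_left₀ (T_ne_zero _)]

/-- Swapping one `a ∈ S \ S'` for some `b ∈ S' \ S` is an instance of `frob_insert` and brings `S`
one step closer to `S'`. -/
lemma smul_frob_part_eq (h : IsSFBasis B Bi) (hμ : μ.card = n + 1) (k : ℕ) :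
    ∀ S S' : Finset (Corner μ), S.card = S'.card → (S \ S').card = k → S.Nonempty →
      (∏ i ∈ Sᶜ, T (pred μ i)) • frob (part B Bi S) =
        (∏ i ∈ S'ᶜ, T (pred μ i)) • frob (part B Bi S') := by
  classical
  induction k with
  | zero =>
    intro S S' hc hk _
    rw [Finset.card_eq_zero, Finset.sdiff_eq_empty_iff_subset] at hk
    rw [Finset.eq_of_subset_of_card_le hk hc.ge]
  | succ k ih =>
    intro S S' hc hk hS
    obtain ⟨a, ha⟩ : (S \ S').Nonempty := Finset.card_pos.mp (by lia)
    have hk' := Finset.card_sdiff_comm hc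
    obtain ⟨b, hb⟩ : (S' \ S).Nonempty := Finset.card_pos.mp (by lia)
    rw [Finset.mem_sdiff] at ha hb
    set R := S.erase a with hR
    have haR : a ∉ R := Finset.notMem_erase a S
    have hbR : b ∉ R := fun h' => hb.2 (Finset.mem_of_mem_erase h')
    have hSa : S = insert a R := (Finset.insert_erase ha.1).symm
    have hcard : (insert b R).card = S'.card := by
      rw [Finset.card_insert_of_notMem hbR, ← hc, hSa, Finset.card_insert_of_notMem haR]
    have hsd : (insert b R \ S').card = k := by
      have h1 : insert b R \ S' = (S \ S').erase a := by
        rw [Finset.insert_sdiff_of_mem _ hb.1, hR, Finset.erase_sdiff_comm]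
      rw [h1, Finset.card_erase_of_mem (Finset.mem_sdiff.mpr ha), hk, Nat.add_sub_cancel]
    rw [← ih (insert b R) S' hcard hsd (Finset.insert_nonempty _ _), hSa]
    have key (x : Corner μ) (hx : x ∉ R) : (∏ i ∈ (insert x R)ᶜ, T (pred μ i)) =
        (∏ i ∈ Rᶜ, T (pred μ i)) * (T (pred μ x))⁻¹ := by
      rw [eq_mul_inv_iff_mul_eq₀ (T_ne_zero _), Finset.compl_insert,
        Finset.prod_erase_mul _ _ (Finset.mem_compl.mpr hx)]
    rw [key a haR, key b hbR, mul_smul, mul_smul, h.frob_insert hμ R haR hbR]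

lemma exists_isPhi (h : IsSFBasis B Bi) (hμ : μ.card = n + 1) :
    ∃ Φ : ℕ → SymFun K, IsPhi B Bi Φ := by
  classical
  -- Any set of size `k` serves to define `Φ k`; the value `0` covers sizes that do not occur.
  refine ⟨fun k => if hk : ∃ S : Finset (Corner μ), S.Nonempty ∧ S.card = k then
    (∏ i ∈ hk.chooseᶜ, T (pred μ i)) • frob (part B Bi hk.choose) else 0, fun S hS => ?_⟩
  have hk : ∃ S' : Finset (Corner μ), S'.Nonempty ∧ S'.card = S.card := ⟨S, hS, rfl⟩
  beta_reduce
  rw [dif_pos hk, ← h.smul_frob_part_eq hμ _ S _ hk.choose_spec.2.symm rfl hS, smul_smul,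
    inv_mul_cancel₀ (Finset.prod_ne_zero_iff.mpr fun _ _ => T_ne_zero _), one_smul]

end IsSFBasis

end Pieces

/- ## The operator `∇` exists

The Macdonald polynomials are pairwise orthogonal for a scalar product that is anisotropic over
`ℚ(q, t)`, so that the nonzero ones are linearly independent. -/

section Anisotropy

/-- The reals algebraic over a countable ring are countable, so their complement is dense. Choose
`b` over `ℚ`, then `a` over `ℚ[b]`. -/
lemma exists_algebraicIndependent_real :
    ∃ a b : ℝ, 0 < a ∧ a < 1 ∧ 1 < b ∧ AlgebraicIndependent ℚ ![a, b] := by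
  obtain ⟨b, hb, hb1, -⟩ := ((Algebraic.countable ℚ ℝ).dense_compl ℝ).exists_between
    (show (1 : ℝ) < 2 by norm_num)
  have h1 : AlgebraicIndependent ℚ ![b] :=
    (algebraicIndependent_unique_type_iff (R := ℚ) (x := ![b])).mpr hb
  have hc : Countable (Algebra.adjoin ℚ (Set.range ![b])) := by
    rw [Algebra.adjoin_range_eq_range_aeval]
    have : Countable (MvPolynomial (Fin 1) ℚ) := 
      (MvPolynomial.basisMonomials (Fin 1) ℚ).repr.injective.countable
    exact (MvPolynomial.aeval ![b] : MvPolynomial (Fin 1) ℚ →ₐ[ℚ] ℝ).rangeRestrict_surjective.countable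
  obtain ⟨a, ha, ha0, ha1⟩ :=
    ((Algebraic.countable (Algebra.adjoin ℚ (Set.range ![b])) ℝ).dense_compl ℝ).exists_between
      (show (0 : ℝ) < 1 by norm_num)
  have h2 := (h1.option_iff_transcendental a).mpr ha
  refine ⟨a, b, ha0, ha1, hb1, ?_⟩
  convert h2.comp (finSuccEquiv 1) (finSuccEquiv 1).injective using 1
  funext i
  fin_cases i <;> rfl

/-- With `q` and `1/t` both in `(0, 1)`, each factor `(1 - q^k)/(1 - t^{-k})` of the norm is
positive. This makes the scalar product anisotropic. -/
lemma exists_real_embedding : ∃ φ : K →+* ℝ, 0 < φ q ∧ φ q < 1 ∧ 1 < φ t := by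
  obtain ⟨a, b, ha, ha1, hb, hab⟩ := exists_algebraicIndependent_real
  have hinj : Function.Injective
    ((MvPolynomial.aeval ![a, b] : MvPolynomial (Fin 2) ℚ →ₐ[ℚ] ℝ) :
      MvPolynomial (Fin 2) ℚ →+* ℝ) := hab
  refine ⟨IsFractionRing.lift hinj, ?_⟩
  rw [q, t, IsFractionRing.lift_algebraMap, IsFractionRing.lift_algebraMap]
  simpa using ⟨ha, ha1, hb⟩

lemma map_powerNorm_pos {φ : K →+* ℝ} (h0 : 0 < φ q) (h1 : φ q < 1) (ht : 1 < φ t)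
    (d : ℕ+ →₀ ℕ) : 0 < φ (powerNorm q t⁻¹ d) := by
  rw [powerNorm, Finsupp.prod, map_prod]
  refine Finset.prod_pos fun k _ => ?_
  simp only [map_mul, map_pow, map_natCast, map_div₀, map_sub, map_one, map_inv₀]
  have hk : (k : ℕ) ≠ 0 := k.ne_zero
  have h2 : φ q ^ (k : ℕ) < 1 := pow_lt_one₀ h0.le h1 hk
  have h3 : (φ t)⁻¹ ^ (k : ℕ) < 1 :=
    pow_lt_one₀ (inv_nonneg.mpr (zero_le_one.trans ht.le)) (inv_lt_one_of_one_lt₀ ht) hk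
  have h4 : (0 : ℝ) < (k : ℕ) := Nat.cast_pos.mpr k.pos
  have h5 := sub_pos.mpr h2
  have h6 := sub_pos.mpr h3
  positivity

lemma scalarProd_self_ne_zero {f : SymFun K} (hf : f ≠ 0) : scalarProd q t⁻¹ f f ≠ 0 := by
  obtain ⟨φ, h0, h1, ht⟩ := exists_real_embedding
  intro h
  have h2 : φ (scalarProd q t⁻¹ f f) = 0 := by rw [h, map_zero]
  rw [scalarProd, map_sum] at h2
  refine (Finset.sum_pos (fun d hd => ?_) (MvPolynomial.support_nonempty.mpr hf)).ne' h2
  rw [map_mul, map_mul]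
  have h3 : φ (f.coeff d) ≠ 0 := (map_ne_zero φ).mpr (MvPolynomial.mem_support_iff.mp hd)
  exact mul_pos (mul_self_pos.mpr h3) (map_powerNorm_pos h0 h1 ht d)

end Anisotropy

/-! ### Homogeneity and orthogonality of Macdonald polynomials -/

section Homogeneous

variable {F : Type} [Field F]

/-- `f` is homogeneous of degree `n`, where `pₖ` has degree `k`. -/
def IsHomog (f : SymFun F) (n : ℕ) : Prop :=
  MvPolynomial.IsWeightedHomogeneous (fun k : ℕ+ => (k : ℕ)) f n

lemma isHomog_psumOfPerm {n : ℕ} (σ : Equiv.Perm (Fin n)) :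
    IsHomog (psumOfPerm σ : SymFun F) n := by
  have key : ∀ s : Multiset ℕ, (∀ k ∈ s, 0 < k) →
      IsHomog ((s.map psum).prod : SymFun F) s.sum := by
    intro s
    induction s using Multiset.induction_on with
    | empty => exact fun _ => MvPolynomial.isWeightedHomogeneous_one F (fun k : ℕ+ => (k : ℕ))
    | cons k s ih =>
      intro hs
      rw [Multiset.map_cons, Multiset.prod_cons, Multiset.sum_cons]
      refine MvPolynomial.IsWeightedHomogeneous.mul ?_
        (ih fun j hj => hs j (Multiset.mem_cons_of_mem hj))
      have h1 := MvPolynomial.isWeightedHomogeneous_X F (fun k : ℕ+ => (k : ℕ)) k.toPNat'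
      have h2 : (k.toPNat' : ℕ) = k := by
        rw [Nat.toPNat'_coe, if_pos (hs k (Multiset.mem_cons_self k s))]
      rwa [h2] at h1
  have h := key σ.partition.parts fun k hk => σ.partition.parts_pos hk
  have hn : σ.partition.parts.sum = n := σ.partition.parts_sum.trans (Fintype.card_fin n)
  rwa [hn] at h

lemma isHomog_hsymm (n : ℕ) : IsHomog (hsymm n : SymFun F) n := by
  rw [IsHomog, ← MvPolynomial.mem_weightedHomogeneousSubmodule]
  exact Submodule.smul_mem _ _ (Submodule.sum_mem _ fun σ _ => isHomog_psumOfPerm σ)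

lemma sum_rowLen (α : YoungDiagram) : ∑ i : Fin (α.colLen 0), α.rowLen i = α.card := by
  rw [YoungDiagram.card, Finset.card_eq_sum_card_fiberwise (f := Prod.fst)
    (t := Finset.range (α.colLen 0)), Finset.sum_range]
  · refine Finset.sum_congr rfl fun i _ => ?_
    rw [YoungDiagram.rowLen_eq_card]; rfl
  · intro c hc
    rw [Finset.mem_coe, YoungDiagram.mem_cells] at hc
    rw [Finset.mem_coe, Finset.mem_range, ← YoungDiagram.mem_iff_lt_colLen]
    exact α.isLowerSet (show (c.1, 0) ≤ c from ⟨le_rfl, Nat.zero_le _⟩) hc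

lemma isHomog_schur (α : YoungDiagram) : IsHomog (schur α : SymFun F) α.card := by
  rw [schur, Matrix.det_apply, IsHomog, ← MvPolynomial.mem_weightedHomogeneousSubmodule]
  refine Submodule.sum_mem _ fun σ _ => ?_
  rw [Units.smul_def]
  refine zsmul_mem ?_ _
  simp only [Matrix.of_apply]
  -- A negative index makes the whole product zero. Otherwise the shifts by `i` and `σ i` cancel in
  -- the total degree.
  by_cases hneg : ∃ i : Fin (α.colLen 0),
      (α.rowLen (σ i) : ℤ) - ((σ i : Fin _) : ℕ) + ((i : Fin _) : ℕ) < 0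
  · obtain ⟨i, hi⟩ := hneg
    rw [Finset.prod_eq_zero (Finset.mem_univ i)]
    · exact zero_mem _
    · rw [hsymmInt, if_pos hi]
  · push Not at hneg
    rw [MvPolynomial.mem_weightedHomogeneousSubmodule]
    have hsum : ∑ i : Fin (α.colLen 0),
        ((α.rowLen (σ i) : ℤ) - ((σ i : Fin _) : ℕ) + ((i : Fin _) : ℕ)).toNat = α.card := by
      zify
      rw [Finset.sum_congr rfl fun i _ => Int.toNat_of_nonneg (hneg i), Finset.sum_add_distrib,
        Finset.sum_sub_distrib, Equiv.sum_comp σ (fun i => (α.rowLen i : ℤ)),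
        Equiv.sum_comp σ (fun i => ((i : ℕ) : ℤ)), sub_add_cancel, ← sum_rowLen]
      push_cast
      rfl
    rw [← hsum]
    refine MvPolynomial.IsWeightedHomogeneous.prod _ _ _ fun i _ => ?_
    rw [hsymmInt, if_neg (not_lt.mpr (hneg i))]
    exact isHomog_hsymm _

/-- When a Macdonald family exists in degree `n`, the polynomials `P_α` with `α ⊢ n` form one. -/
lemma exists_family {a b : F} {n : ℕ}
    (h : ∃ P : YoungDiagram → SymFun F, IsMacdonaldFamily a b n P) :
    ∃ P : YoungDiagram → SymFun F, IsMacdonaldFamily a b n P ∧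
      ∀ α : YoungDiagram, α.card = n → macdonaldP a b α = P α := by
  refine ⟨h.choose, h.choose_spec, ?_⟩
  rintro α rfl
  rw [macdonaldP, dif_pos h]

lemma isHomog_macdonaldP (a b : F) (α : YoungDiagram) : IsHomog (macdonaldP a b α) α.card := by
  by_cases h : ∃ P : YoungDiagram → SymFun F, IsMacdonaldFamily a b α.card P
  · obtain ⟨P, hP, hPα⟩ := exists_family h
    rw [hPα α rfl, IsHomog, ← MvPolynomial.mem_weightedHomogeneousSubmodule,
      ← sub_add_cancel (P α) (schur α)]
    refine add_mem ?_ (isHomog_schur α)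
    refine (Submodule.span_le.mpr ?_) (hP.1 α rfl)
    rintro _ ⟨β, hβ, rfl⟩
    rw [← hβ.1]
    exact isHomog_schur β
  · rw [macdonaldP, dif_neg h]
    exact MvPolynomial.isWeightedHomogeneous_zero F _ _

/-- In different degrees the supports are disjoint. In the same degree this is the defining
orthogonality, or `P_α` is the default `0`. -/
lemma scalarProd_macdonaldP {a b : F} {α β : YoungDiagram} (hαβ : α ≠ β) :
    scalarProd a b (macdonaldP a b α) (macdonaldP a b β) = 0 := by
  by_cases hc : β.card = α.card
  · by_cases h : ∃ P : YoungDiagram → SymFun F, IsMacdonaldFamily a b α.card P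
    · obtain ⟨P, hP, hPα⟩ := exists_family h
      rw [hPα α rfl, hPα β hc]
      exact hP.2 α β rfl hc hαβ
    · rw [macdonaldP, dif_neg h, scalarProd]
      simp
  · refine Finset.sum_eq_zero fun d hd => ?_
    have h1 := isHomog_macdonaldP a b α (MvPolynomial.mem_support_iff.mp hd)
    have h2 : (macdonaldP a b β).coeff d = 0 := by
      by_contra h2
      exact hc ((isHomog_macdonaldP a b β h2).symm.trans h1)
    rw [h2, mul_zero, zero_mul]

/-- `⟨·, g⟩` as a linear form. -/
noncomputable def scalarProdRight (a b : F) (g : SymFun F) : SymFun F →ₗ[F] F :=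
  (MvPolynomial.basisMonomials ℕ+ F).constr F fun d => g.coeff d * powerNorm a b d

lemma scalarProdRight_apply (a b : F) (f g : SymFun F) :
    scalarProdRight a b g f = scalarProd a b f g := by
  rw [scalarProdRight, Module.Basis.constr_apply, scalarProd]
  simp only [mul_assoc]
  rfl

end Homogeneous

lemma linearIndependent_macdonaldP :
    LinearIndependent K fun α : {α : YoungDiagram // macdonaldP q t⁻¹ α ≠ 0} =>
      macdonaldP q t⁻¹ α.1 := by
  rw [linearIndependent_iff']
  intro s c hc β hβ
  have h := congrArg (scalarProdRight q t⁻¹ (macdonaldP q t⁻¹ β.1)) hc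
  rw [map_sum, map_zero, Finset.sum_eq_single β] at h
  · rw [map_smul, scalarProdRight_apply, smul_eq_mul] at h
    exact (mul_eq_zero.mp h).resolve_right (scalarProd_self_ne_zero β.2)
  · intro α _ hα
    rw [map_smul, scalarProdRight_apply,
      scalarProd_macdonaldP (fun h' => hα (Subtype.ext h')), smul_zero]
  · exact fun h' => absurd hβ h'

lemma plethDiv_injective {F : Type} [Field F] {b : F} (hb : ∀ k : ℕ+, 1 - b ^ (k : ℕ) ≠ 0) :
    Function.Injective (plethDiv b) := by
  let ψ : SymFun F →ₐ[F] SymFun F :=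
    MvPolynomial.aeval fun k : ℕ+ => (1 - b ^ (k : ℕ)) • (MvPolynomial.X k : SymFun F)
  refine Function.LeftInverse.injective (g := ψ) fun f => ?_
  have : ψ.comp (plethDiv b) = AlgHom.id F _ := by
    ext k : 1
    simp [plethDiv, ψ, smul_smul, inv_mul_cancel₀ (hb k)]
  exact congrArg (fun g : SymFun F →ₐ[F] SymFun F => g f) this

lemma one_sub_inv_t_pow_ne_zero (k : ℕ+) : 1 - t⁻¹ ^ (k : ℕ) ≠ 0 := by
  obtain ⟨φ, -, -, ht⟩ := exists_real_embedding
  intro h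
  have h1 := congrArg φ h
  rw [map_sub, map_pow, map_inv₀, map_one, map_zero, sub_eq_zero] at h1
  exact (pow_lt_one₀ (inv_nonneg.mpr (zero_le_one.trans ht.le)) (inv_lt_one_of_one_lt₀ ht)
    k.ne_zero).ne h1.symm

lemma exists_nabla :
    ∃ N : SymFun K ≃ₗ[K] SymFun K, ∀ α : YoungDiagram, N (Htilde α) = T α • Htilde α := by
  classical
  have hli := linearIndependent_macdonaldP.map' (plethDiv t⁻¹).toLinearMap
    (LinearMap.ker_eq_bot.mpr (plethDiv_injective one_sub_inv_t_pow_ne_zero))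
  let b := Module.Basis.sumExtend hli
  -- Eigenvalue `T_α` on the independent family and `1` on the added basis vectors; all are units,
  -- so the map is invertible.
  let c : {α : YoungDiagram // macdonaldP q t⁻¹ α ≠ 0} ⊕ Module.Basis.sumExtendIndex hli → Kˣ :=
    Sum.elim (fun α => Units.mk0 (T α.1) (T_ne_zero α.1)) (fun _ => 1)
  refine ⟨b.equiv (b.unitsSMul c) (Equiv.refl _), fun α => ?_⟩
  by_cases hα : macdonaldP q t⁻¹ α = 0
  · simp [Htilde, macdonaldH, macdonaldJ, hα]
  · have h1 : b (Sum.inl ⟨α, hα⟩) = plethDiv t⁻¹ (macdonaldP q t⁻¹ α) := by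
      simp only [b, Module.Basis.sumExtend, Module.Basis.reindex_apply]
      exact Module.Basis.extend_apply_self _ _
    have h2 : b.equiv (b.unitsSMul c) (Equiv.refl _) (plethDiv t⁻¹ (macdonaldP q t⁻¹ α)) =
        T α • plethDiv t⁻¹ (macdonaldP q t⁻¹ α) := by
      rw [← h1, Module.Basis.equiv_apply, Equiv.refl_apply, Module.Basis.unitsSMul_apply]
      rfl
    simp only [Htilde, macdonaldH, macdonaldJ, map_smul, h2]
    rw [smul_comm (T α), smul_comm (T α)]

lemma nabla_Htilde (α : YoungDiagram) : nabla (Htilde α) = T α • Htilde α := by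
  rw [nabla, dif_pos exists_nabla]
  exact exists_nabla.choose_spec α

/- ## Elementary symmetric functions and Lagrange interpolation -/

section Interpolation

variable {ι : Type*} [Fintype ι] {F : Type*} [Field F]

/-- Vieta: this is `∏ (X - x_s)` evaluated at its root `x i`. -/
lemma sum_esymm_mul_pow (x : ι → F) (i : ι) :
    ∑ j ∈ Finset.range (Fintype.card ι + 1),
      (-1) ^ j * ((Finset.univ.val.map x).esymm j * x i ^ (Fintype.card ι - j)) = 0 := by
  have h := congrArg (Polynomial.eval (x i))
    (Multiset.prod_X_sub_X_eq_sum_esymm (Finset.univ.val.map x))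
  rw [Polynomial.eval_multiset_prod, Multiset.prod_eq_zero, Polynomial.eval_finsetSum] at h
  · simpa using h.symm
  · simp only [Multiset.mem_map]
    exact ⟨_, ⟨x i, ⟨i, by simp⟩, rfl⟩, by simp⟩

/-- Vieta's relation with the last term, `e_m = ∏ x_s`, moved to the other side. -/
lemma sum_Icc_esymm_sub (x : ι → F) (i : ι) :
    (∑ k ∈ Finset.Icc 1 (Fintype.card ι), (-1) ^ (Fintype.card ι - k) *
      (Finset.univ.val.map x).esymm (Fintype.card ι - k) * x i ^ (k - 1)) * x i =
      (-1) ^ (Fintype.card ι - 1) * ∏ s, x s := by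
  set m := Fintype.card ι with hm
  have hpos : 0 < m := Fintype.card_pos_iff.mpr ⟨i⟩
  have h := sum_esymm_mul_pow x i
  rw [Finset.sum_range_succ, ← hm] at h
  have hlast : (Finset.univ.val.map x).esymm m = ∏ s, x s := by
    rw [Finset.esymm_map_val, ← Finset.card_univ.trans hm.symm, Finset.powersetCard_self,
      Finset.sum_singleton]
  rw [hlast, Nat.sub_self, pow_zero, mul_one] at h
  have h2 : (∑ k ∈ Finset.Icc 1 m, (-1) ^ (m - k) *
      (Finset.univ.val.map x).esymm (m - k) * x i ^ (k - 1)) * x i =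
      ∑ j ∈ Finset.range m, (-1) ^ j * ((Finset.univ.val.map x).esymm j * x i ^ (m - j)) := by
    rw [Finset.sum_mul]
    refine Finset.sum_nbij' (fun k => m - k) (fun j => m - j) ?_ ?_ ?_ ?_ ?_
    · intro k hk; rw [Finset.mem_Icc] at hk; rw [Finset.mem_range]; lia
    · intro k hk; rw [Finset.mem_range] at hk; rw [Finset.mem_Icc]; lia
    · intro k hk; rw [Finset.mem_Icc] at hk; lia
    · intro k hk; rw [Finset.mem_range] at hk; lia
    · intro k hk
      rw [Finset.mem_Icc] at hk
      rw [Nat.sub_sub_self hk.2, mul_assoc, mul_assoc, ← pow_succ, Nat.sub_add_cancel hk.1]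
  rw [h2, eq_neg_of_add_eq_zero_left h]
  obtain ⟨l, hl⟩ := Nat.exists_eq_succ_of_ne_zero hpos.ne'
  rw [hl, Nat.succ_sub_one, pow_succ]
  ring

/-- The same relation with the first term, `e_0 xᵢ^m`, moved instead. -/
lemma sum_Icc_esymm_succ_sub (x : ι → F) (i : ι) :
    ∑ k ∈ Finset.Icc 1 (Fintype.card ι), (-1) ^ (Fintype.card ι - k) *
      (Finset.univ.val.map x).esymm (Fintype.card ι + 1 - k) * x i ^ (k - 1) =
      x i ^ Fintype.card ι := by
  set m := Fintype.card ι with hm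
  have h := sum_esymm_mul_pow x i
  rw [Finset.sum_range_succ', ← hm] at h
  have h0 : (Finset.univ.val.map x).esymm 0 = 1 := by simp [Finset.esymm_map_val]
  rw [h0, pow_zero, one_mul, one_mul, Nat.sub_zero] at h
  rw [eq_neg_of_add_eq_zero_right h, ← Finset.sum_neg_distrib]
  refine Finset.sum_nbij' (fun k => m - k) (fun j => m - j) ?_ ?_ ?_ ?_ ?_
  · intro k hk; rw [Finset.mem_Icc] at hk; rw [Finset.mem_range]; lia
  · intro k hk; rw [Finset.mem_range] at hk; rw [Finset.mem_Icc]; lia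
  · intro k hk; rw [Finset.mem_Icc] at hk; lia
  · intro k hk; rw [Finset.mem_range] at hk; lia
  · intro k hk
    rw [Finset.mem_Icc] at hk
    rw [show m + 1 - k = m - k + 1 by lia, show m - (m - k + 1) = k - 1 by lia, pow_succ]
    ring

variable [DecidableEq ι]

/-- The Lagrange weight `∏_{s ≠ i} 1 / (xᵢ - x_s)`. -/
def lagrangeWeight (x : ι → F) (i : ι) : F := ∏ s ∈ Finset.univ.erase i, (x i - x s)⁻¹

/-- Since `r < m`, `X^r` equals its own Lagrange interpolant at the `m` nodes; compare coefficients
of `X^k`. -/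
lemma sum_lagrangeWeight_mul_esymm {x : ι → F} (hx : Function.Injective x) {r k : ℕ}
    (hr : r < Fintype.card ι) (hk : k < Fintype.card ι) :
    ∑ i, lagrangeWeight x i * x i ^ r *
        ((-1) ^ (Fintype.card ι - 1 - k) *
          ((Finset.univ.erase i).val.map x).esymm (Fintype.card ι - 1 - k)) =
      if k = r then 1 else 0 := by
  have hint := Lagrange.eq_interpolate (f := (Polynomial.X ^ r : Polynomial F)) (v := x)
    (s := Finset.univ) hx.injOn (by rw [Polynomial.degree_X_pow]; exact_mod_cast hr)
  have hc := congrArg (fun p => Polynomial.coeff p k) hint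
  simp only [Polynomial.coeff_X_pow, Lagrange.interpolate_apply, Polynomial.finsetSum_coeff] at hc
  rw [hc]
  refine Finset.sum_congr rfl fun i _ => ?_
  have hcard : Multiset.card ((Finset.univ.erase i).val.map x) = Fintype.card ι - 1 := by
    simp
  have hb : Lagrange.basis Finset.univ x i = Polynomial.C (lagrangeWeight x i) *
      (((Finset.univ.erase i).val.map x).map fun a => Polynomial.X - Polynomial.C a).prod := by
    rw [Lagrange.basis, lagrangeWeight, map_prod, Multiset.map_map]
    simp only [Lagrange.basisDivisor, Finset.prod_mul_distrib]
    rfl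
  rw [hb, Polynomial.coeff_C_mul, Polynomial.coeff_C_mul,
    Multiset.prod_X_sub_C_coeff _ (by rw [hcard]; lia), hcard]
  simp only [Polynomial.eval_pow, Polynomial.eval_X]
  ring

/-- If the `H i` are the combinations of the `Φ k` with coefficients `e_{m-k}` in the `x s`,
`s ≠ i`, then the `Φ k` are recovered from the `H i` by Lagrange interpolation. -/
lemma eq_sum_lagrangeWeight_smul {M : Type*} [AddCommGroup M] [Module F M] {x : ι → F}
    (hx : Function.Injective x) {H : ι → M} {Φ : ℕ → M}
    (hH : ∀ i, H i = ∑ k ∈ Finset.Icc 1 (Fintype.card ι),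
      ((Finset.univ.erase i).val.map x).esymm (Fintype.card ι - k) • Φ k)
    {k : ℕ} (hk : k ∈ Finset.Icc 1 (Fintype.card ι)) :
    Φ k = ∑ i, ((-1) ^ (Fintype.card ι - k) * (lagrangeWeight x i * x i ^ (k - 1))) • H i := by
  rw [Finset.mem_Icc] at hk
  simp only [hH, Finset.smul_sum, smul_smul]
  rw [Finset.sum_comm]
  simp only [← Finset.sum_smul]
  rw [Finset.sum_eq_single_of_mem k (Finset.mem_Icc.mpr hk)]
  · have h := sum_lagrangeWeight_mul_esymm hx (r := k - 1) (k := k - 1) (by lia) (by lia)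
    rw [if_pos rfl, show Fintype.card ι - 1 - (k - 1) = Fintype.card ι - k by lia] at h
    conv_lhs => rw [← one_smul F (Φ k), ← h]
    congr 1
    exact Finset.sum_congr rfl fun i _ => by ring
  · intro j hj hne
    rw [Finset.mem_Icc] at hj
    have h := sum_lagrangeWeight_mul_esymm hx (r := k - 1) (k := j - 1) (by lia) (by lia)
    rw [if_neg (by lia), show Fintype.card ι - 1 - (j - 1) = Fintype.card ι - j by lia] at h
    have h1 : ((-1 : F) ^ (Fintype.card ι - j)) * (-1) ^ (Fintype.card ι - j) = 1 := by
      rw [← mul_pow]; simp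
    convert zero_smul F (Φ j)
    rw [← mul_zero ((-1 : F) ^ (Fintype.card ι - k) * (-1) ^ (Fintype.card ι - j)), ← h,
      Finset.mul_sum]
    refine Finset.sum_congr rfl fun i _ => ?_
    linear_combination (-(-1 : F) ^ (Fintype.card ι - k) * lagrangeWeight x i * x i ^ (k - 1) *
      ((Finset.univ.erase i).val.map x).esymm (Fintype.card ι - j)) * h1

/-- Rewrites a combination of the `Φ k` in the `H i`, on which `∇` will act by scalars. -/
lemma sum_esymm_smul {M : Type*} [AddCommGroup M] [Module F M] {x : ι → F}
    (hx : Function.Injective x) {H : ι → M} {Φ : ℕ → M}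
    (hH : ∀ i, H i = ∑ k ∈ Finset.Icc 1 (Fintype.card ι),
      ((Finset.univ.erase i).val.map x).esymm (Fintype.card ι - k) • Φ k)
    (c : ℕ → F) :
    ∑ k ∈ Finset.Icc 1 (Fintype.card ι), c k • Φ k =
      ∑ i, (lagrangeWeight x i * ∑ k ∈ Finset.Icc 1 (Fintype.card ι),
        (-1) ^ (Fintype.card ι - k) * c k * x i ^ (k - 1)) • H i := by
  rw [Finset.sum_congr rfl fun k hk => by rw [eq_sum_lagrangeWeight_smul hx hH hk]]
  simp only [Finset.smul_sum, smul_smul]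
  rw [Finset.sum_comm]
  refine Finset.sum_congr rfl fun i _ => ?_
  rw [← Finset.sum_smul, Finset.mul_sum]
  congr 1
  exact Finset.sum_congr rfl fun k _ => by ring

/-- Sums over the sets `S` with `Sᶜ ⊆ V`, collected according to the size of `S`. -/
lemma sum_compl_subset {M : Type*} [AddCommGroup M] [Module F M] (x : ι → F) (V : Finset ι)
    (Φ : ℕ → M) :
    ∑ S : Finset ι with S.Nonempty ∧ Sᶜ ⊆ V, (∏ i ∈ Sᶜ, x i) • Φ S.card =
      ∑ k ∈ Finset.Icc 1 (Fintype.card ι), (V.val.map x).esymm (Fintype.card ι - k) • Φ k := by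
  rw [← Finset.sum_fiberwise_of_maps_to (g := Finset.card) (t := Finset.Icc 1 (Fintype.card ι))]
  · refine Finset.sum_congr rfl fun k hk => ?_
    rw [Finset.mem_Icc] at hk
    rw [Finset.esymm_map_val, Finset.sum_smul]
    refine Finset.sum_nbij' compl compl ?_ ?_ ?_ ?_ ?_
    · intro S hS
      simp only [Finset.mem_filter, Finset.mem_univ, true_and] at hS
      rw [Finset.mem_powersetCard, Finset.card_compl, hS.2]
      exact ⟨hS.1.2, rfl⟩
    · intro U hU
      rw [Finset.mem_powersetCard] at hU
      have hc : Uᶜ.card = k := by rw [Finset.card_compl, hU.2]; lia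
      simp only [Finset.mem_filter, Finset.mem_univ, true_and, compl_compl]
      exact ⟨⟨Finset.card_pos.mp (by lia), hU.1⟩, hc⟩
    · exact fun S _ => compl_compl S
    · exact fun S _ => compl_compl S
    · intro S hS
      rw [(Finset.mem_filter.mp hS).2]
  · intro S hS
    simp only [Finset.mem_filter, Finset.mem_univ, true_and] at hS
    exact Finset.mem_Icc.mpr ⟨Finset.card_pos.mpr hS.1, Finset.card_le_univ S⟩

end Interpolation

/- ## Corners -/

section Corners

variable {μ : YoungDiagram}

lemma tqPow_injective : Function.Injective tqPow := by
  have key (d : ℕ × ℕ) : tqPow d = algebraMap (MvPolynomial (Fin 2) ℚ) K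
      (MvPolynomial.monomial (Finsupp.single 1 d.1 + Finsupp.single 0 d.2) 1) := by
    rw [tqPow, t, q, ← map_pow, ← map_pow, ← map_mul, MvPolynomial.X_pow_eq_monomial,
      MvPolynomial.X_pow_eq_monomial, MvPolynomial.monomial_mul, mul_one]
  intro d e h
  rw [key, key] at h
  have h1 := MvPolynomial.monomial_left_injective one_ne_zero
    (IsFractionRing.injective (MvPolynomial (Fin 2) ℚ) K h)
  have h2 := DFunLike.congr_fun h1 0
  have h3 := DFunLike.congr_fun h1 1
  simp at h2 h3
  exact Prod.ext h3 h2

lemma T_pred_mul (i : Corner μ) : T (pred μ i) * tqPow i.1 = T μ :=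
  Finset.prod_erase_mul _ _ (Finset.mem_filter.mp i.2).1

/-- `T_μ / Tᵢ` is the monomial of the removed corner, which determines that corner. -/
lemma T_pred_injective : Function.Injective fun i : Corner μ => T (pred μ i) := by
  intro i j h
  have h1 := (T_pred_mul i).trans (T_pred_mul j).symm
  rw [show T (pred μ i) = T (pred μ j) from h] at h1
  exact Subtype.ext (tqPow_injective (mul_left_cancel₀ (T_ne_zero _) h1))

lemma nonempty_corner (hμ : μ.card ≠ 0) : Nonempty (Corner μ) := by
  obtain ⟨c, hc, hmax⟩ := μ.cells.exists_max_image (fun c => c.1 + c.2)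
    -- A cell maximizing row plus column index is a corner.
    (Finset.card_ne_zero.mp hμ)
  refine ⟨⟨c, Finset.mem_filter.mpr ⟨hc, fun h => ?_, fun h => ?_⟩⟩⟩
  · have := hmax _ ((YoungDiagram.mem_cells _).mpr h)
    lia
  · have := hmax _ ((YoungDiagram.mem_cells _).mpr h)
    lia

end Corners

end MacdonaldSF

/-! ### Assembly, in the variables `xᵢ = 1/Tᵢ` -/

theorem theorem3p2 (n : ℕ) (μ : YoungDiagram) (hμ : μ.card = n + 1)
    (B : Set (XYPoly n)) (Bi : Corner μ → Set (XYPoly n)) (hSF : IsSFBasis B Bi)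
    (hCH : ∀ i : Corner μ, frob (GHModule n (pred μ i)) = Htilde (pred μ i)) :
    (∃ Φ : ℕ → SymFun K, IsPhi B Bi Φ) ∧
    ∀ Φ : ℕ → SymFun K, IsPhi B Bi Φ →
      frob (⨆ i : Corner μ, GHModule n (pred μ i)) =
          ∑ k ∈ Finset.Icc 1 (corners μ).card, eInvT μ ((corners μ).card - k) • Φ k ∧
      ∑ k ∈ Finset.Icc 1 (corners μ).card, eInvT μ ((corners μ).card - k) • Φ k =
          (∏ i : Corner μ, T (pred μ i))⁻¹ • nabla (Φ 1) ∧
      ∑ k ∈ Finset.Icc 1 (corners μ).card, eInvT μ ((corners μ).card + 1 - k) • Φ k =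
          nabla.symm (PhiMu μ) := by
  classical
  refine ⟨hSF.exists_isPhi hμ, fun Φ hΦ => ?_⟩
  have hm : (corners μ).card = Fintype.card (Corner μ) := (Fintype.card_coe _).symm
  rw [hm]
  set m := Fintype.card (Corner μ)
  have hm1 : 1 ≤ m := Fintype.card_pos_iff.mpr (nonempty_corner (by rw [hμ]; exact n.succ_ne_zero))
  set x : Corner μ → K := fun i => (T (pred μ i))⁻¹ with hx
  have hx0 (i) : x i ≠ 0 := inv_ne_zero (T_ne_zero _)
  have hTx (i) : T (pred μ i) = (x i)⁻¹ := (inv_inv _).symm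
  have hxinj : Function.Injective x := fun i j h => T_pred_injective (inv_injective h)
  have hpart (S : Finset (Corner μ)) (hS : S.Nonempty) :
      frob (part B Bi S) = (∏ i ∈ Sᶜ, x i) • Φ S.card := by
    rw [hΦ S hS, Finset.prod_inv_distrib]
  have hH (i : Corner μ) : Htilde (pred μ i) = ∑ k ∈ Finset.Icc 1 m,
      ((Finset.univ.erase i).val.map x).esymm (m - k) • Φ k := by
    -- The parts making up `M_{α(i)}` are those with `i ∈ S`, that is, with `Sᶜ` avoiding `i`.
    rw [← hCH, hSF.GHModule_eq, hSF.frob_span (fun S => i ∈ S), ← sum_compl_subset]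
    refine Finset.sum_congr ?_ fun S hS => hpart S (Finset.mem_filter.mp hS).2.1
    ext S
    simp only [Finset.mem_filter, Finset.mem_univ, true_and]
    refine ⟨fun h => ⟨⟨i, h⟩, fun j hj => ?_⟩, fun h => ?_⟩
    · rw [Finset.mem_erase]
      exact ⟨fun hji => Finset.mem_compl.mp hj (hji ▸ h), Finset.mem_univ j⟩
    · by_contra hi
      exact Finset.notMem_erase i _ (h.2 (Finset.mem_compl.mpr hi))
  have he (j : ℕ) : eInvT μ j = (Finset.univ.val.map x).esymm j := rfl
  refine ⟨?_, ?_, ?_⟩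
  · rw [hSF.iSup_eq, hSF.frob_span (fun S => S.Nonempty)]
    simp only [he]
    rw [← sum_compl_subset]
    refine Finset.sum_congr (by simp only [Finset.subset_univ, and_true]) fun S hS =>
      hpart S (Finset.mem_filter.mp hS).2.1
  · rw [sum_esymm_smul hxinj hH, eq_sum_lagrangeWeight_smul hxinj hH
      (Finset.mem_Icc.mpr ⟨le_rfl, hm1⟩), map_sum, Finset.smul_sum]
    refine Finset.sum_congr rfl fun i _ => ?_
    rw [map_smul, nabla_Htilde, smul_smul, smul_smul, hTx, ← Finset.prod_inv_distrib]
    congr 1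
    have h := sum_Icc_esymm_sub x i
    simp only [he]
    rw [← eq_mul_inv_iff_mul_eq₀ (hx0 i)] at h
    rw [h, Nat.sub_self, pow_zero]
    ring
  · rw [LinearEquiv.eq_symm_apply, sum_esymm_smul hxinj hH, map_sum, PhiMu]
    refine Finset.sum_congr rfl fun i _ => ?_
    simp only [he]
    rw [sum_Icc_esymm_succ_sub, map_smul, nabla_Htilde, smul_smul]
    congr 1
    -- The eigenvalue `Tᵢ = 1/xᵢ` leaves `xᵢ^{m-1}`, one factor for each `s ≠ i`, which turns `1/(xᵢ
    -- - x_s)` into `1/(1 - Tᵢ/T_s)`.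
    have hpow : x i ^ m * T (pred μ i) = ∏ s ∈ Finset.univ.erase i, x i := by
      rw [Finset.prod_const, Finset.card_erase_of_mem (Finset.mem_univ i), Finset.card_univ, hTx,
        mul_inv_eq_iff_eq_mul₀ (hx0 i), ← pow_succ, Nat.sub_add_cancel hm1]
    rw [mul_assoc, hpow, lagrangeWeight, ← Finset.prod_mul_distrib]
    refine Finset.prod_congr rfl fun s hs => ?_
    have h1 : 1 - T (pred μ i) / T (pred μ s) = (x i - x s) * (x i)⁻¹ := by
      rw [sub_mul, mul_inv_cancel₀ (hx0 i), hTx i, div_eq_inv_mul]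
    rw [h1, mul_inv, inv_inv]
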